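/- Graphs are simple and may be finite or infinite. For vertices $x,y$ of a connected graph $G$, let $I_G(x,y)$ be the set of vertices of all shortest $(x,y)$-paths. A set $C\subseteq V(G)$ is convex if $I_G(x,y)\subseteq C$ for all $x,y\in C$; the convex hull $co_G(A)$ is the smallest convex set containing $A$; and $\mathcal I_G(A):=\bigcup_{x,y\in A}I_G(x,y)$. A copoint at a vertex $x$ is a convex set that is maximal among the convex sets not containing $x$. The pre-hull number $ph(G)$ is the least integer $n\ge 0$ such that $co_G(C\cup\{x\})=\mathcal I_G^{\,n}(C\cup\{x\})$ for every vertex $x$ and every copoint $C$ at $x$ (and $\infty$ if there is no such $n$). A partial cube is a connected graph isomorphic to an isometric (distance-preserving) subgraph of a hypercube, where the hypercube over a set $I$ (finite or infinite) has the finite subsets of $I$ as vertices, two of them being adjacent if and only if they differ in exactly one element. A Peano partial cube is a partial cube $G$ such that $ph(F)\le 1$ for every finite convex (induced) subgraph $F$ of $G$. A median graph is a graph in which, for all vertices $x,y,z$, the set $I_G(x,y)\cap I_G(y,z)\cap I_G(z,x)$ has exactly one element. The Helly number $h(G)$ is the smallest integer $h\ge 0$, if it exists, such that every finite family of convex sets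 of $G$, any at most $h$ of whose members have a common vertex, has a non-empty intersection. **Theorem.** Let $G$ be a Peano partial cube. Then its Helly number exists and satisfies $h(G)\le 3$, with equality $h(G)=3$ if and only if $G$ is not a median graph. -/

import Mathlib

namespace SimpleGraph

universe u

variable {V : Type u} (G : SimpleGraph V)

/-- The geodesic interval `I_G(x, y)`: the vertices of all `(x, y)`-geodesics.  (A walk whose
length is the distance of its ends is a shortest path.) -/
def geodInterval (x y : V) : Set V :=
  {z | ∃ p : G.Walk x y, p.length = G.dist x y ∧ z ∈ p.support}

/-- The convex sets of the geodesic convexity. -/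
def IsGeodConvex (C : Set V) : Prop :=
  ∀ x ∈ C, ∀ y ∈ C, G.geodInterval x y ⊆ C

/-- The convex hull `co_G(A)`: the smallest convex set containing `A`. -/
def geodHull (A : Set V) : Set V :=
  ⋂₀ {C | G.IsGeodConvex C ∧ A ⊆ C}

/-- The pre-hull operator `A ↦ ⋃ x, y ∈ A, I_G(x, y)`. -/
def preHull (A : Set V) : Set V :=
  ⋃ x ∈ A, ⋃ y ∈ A, G.geodInterval x y

/-- `C` is a copoint at `x`: a convex set that is maximal among those avoiding `x`. -/
def IsCopointAt (C : Set V) (x : V) : Prop :=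
  Maximal (fun D : Set V => G.IsGeodConvex D ∧ x ∉ D) C

/-- The pre-hull number `ph(G)`: the least `n` such that `n` iterations of the pre-hull operator
give the convex hull of `C ∪ {x}` for every vertex `x` and every copoint `C` at `x`, and `⊤` if
there is no such `n`. -/
noncomputable def preHullNumber : ℕ∞ :=
  sInf {m : ℕ∞ | ∃ n : ℕ, m = n ∧ ∀ (x : V) (C : Set V), G.IsCopointAt C x →
    G.geodHull (C ∪ {x}) = (G.preHull)^[n] (C ∪ {x})}

/-- Every finite convex subgraph has pre-hull number at most `1`. -/
def IsPhHomogeneous : Prop :=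
  ∀ S : Set V, S.Finite → G.IsGeodConvex S → (G.induce S).preHullNumber ≤ 1

open scoped Classical in
/-- The hypercube over an index set `I` (the weak Cartesian power of `K₂`): its vertices are the
finite subsets of `I`, two of them being adjacent when they differ in exactly one element. -/
noncomputable def hypercube (I : Type u) : SimpleGraph (Finset I) where
  Adj A B := (symmDiff A B).card = 1
  symm := ⟨fun A B h => by rwa [symmDiff_comm]⟩
  loopless := ⟨fun A h => by simp at h⟩

/-- Partial cubes: connected graphs that embed isometrically in a hypercube. -/
def IsPartialCube : Prop :=
  G.Connected ∧ ∃ (I : Type u) (f : V → Finset I),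
    ∀ x y : V, (hypercube I).dist (f x) (f y) = G.dist x y

/-- Peano partial cubes: the partial cubes that are ph-homogeneous. -/
def IsPeanoPartialCube : Prop :=
  G.IsPartialCube ∧ G.IsPhHomogeneous

/-- Median graphs: every triple of vertices has a unique median. -/
def IsMedianGraph : Prop :=
  ∀ x y z : V, ∃! m : V,
    m ∈ G.geodInterval x y ∩ G.geodInterval y z ∩ G.geodInterval z x

/-- Every finite family of `h`-wise non-disjoint convex sets has a non-empty intersection, where
`h`-wise non-disjoint means that any at most `h` members of the family have a common element. -/
def HasHellyProperty (h : ℕ) : Prop :=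
  ∀ (n : ℕ) (F : Fin n → Set V), (∀ i, G.IsGeodConvex (F i)) →
    (∀ s : Finset (Fin n), s.card ≤ h → (⋂ i ∈ s, F i).Nonempty) → (⋂ i, F i).Nonempty

/-- The Helly number: the least `h` with the Helly property, and `⊤` if there is none. -/
noncomputable def hellyNumber : ℕ∞ :=
  sInf {m : ℕ∞ | ∃ h : ℕ, m = h ∧ G.HasHellyProperty h}

end SimpleGraph

/-! ### Betweenness, convexity and half-spaces in Boolean labellings -/

namespace CubeLabel

variable {V : Type*} {I : Type*}

/-! Hypercube coordinates turn geodesic convexity into coordinatewise betweenness, and a vertex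
outside a nonempty convex set is cut off by a half-space. The pre-hull condition enters only as
`Stable` for finite convex sets.

Suppose triples do not suffice. Passing to the hull of finitely many witnesses, then to half-spaces,
then to a smallest bad family, leaves four half-spaces with empty intersection, any three of which
meet inside a finite convex set (`IsQuad`). In a smallest such set (`IsCritical`), suitably maximal
half-spaces are spanned by their fronts (`Tight`), and every vertex has an antipode with respect to
all tight coordinates. Hence tight coordinates behave like lines of a projective plane, an empty
octant of three coordinates meaning that the lines are concurrent (`concurrent_trans`). The lines of
a tight quadruple form a complete quadrilateral, and `exists_tight_separates` supplies lines joining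
opposite vertices. Three uses of it yield a tight quadruple with a strictly smaller triple
intersection (`exists_smaller`), which finiteness forbids (`not_isQuad`).

For the equality case, medians give the Helly property for pairs. Conversely, that property applied
to the three intervals of a triple gives a median, which is automatically unique in a partial cube.
-/

/-- `z` lies coordinatewise between `x` and `y`. -/
def Btw (σ : V → I → Bool) (x z y : V) : Prop :=
  ∀ i, σ x i = σ y i → σ z i = σ x i

/-- The sets closed under betweenness. -/
def BtwConvex (σ : V → I → Bool) (C : Set V) : Prop :=
  ∀ x ∈ C, ∀ y ∈ C, ∀ z, Btw σ x z y → z ∈ C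

/-- The smallest `BtwConvex` set containing `A`. -/
def hull (σ : V → I → Bool) (A : Set V) : Set V :=
  ⋂₀ {C | BtwConvex σ C ∧ A ⊆ C}

/-- The half-space of the points whose coordinate `h.1` is `h.2`. -/
def half (σ : V → I → Bool) (h : I × Bool) : Set V :=
  {v | σ v h.1 = h.2}

/-- The (label of the) complementary half-space. -/
def opp (h : I × Bool) : I × Bool := (h.1, !h.2)

/-- `u'` arises from `u` by changing exactly the coordinate `i`. -/
def Flip (σ : V → I → Bool) (i : I) (u u' : V) : Prop :=
  σ u' i ≠ σ u i ∧ ∀ j, j ≠ i → σ u' j = σ u j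

/-- The points of `C` in the half-space `h` with a neighbour in `C` across `h`. -/
def front (σ : V → I → Bool) (C : Set V) (h : I × Bool) : Set V :=
  {u | u ∈ C ∧ u ∈ half σ h ∧ ∃ u' ∈ C, Flip σ h.1 u u'}

/-- The labellings of the vertices of isometric subgraphs of hypercubes. -/
structure Isometric (σ : V → I → Bool) : Prop where
  finite_diff : ∀ x y, {i | σ x i ≠ σ y i}.Finite
  step : ∀ x y, x ≠ y → ∃ z i, σ x i ≠ σ y i ∧ Flip σ i x z

/-- Any two points of the hull of the front of `C` at `h` extend to a point of this front. -/
def Stable (σ : V → I → Bool) (C : Set V) : Prop :=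
  ∀ h, ∀ x ∈ hull σ (front σ C h), ∀ y ∈ hull σ (front σ C h), ∃ w ∈ front σ C h, Btw σ x y w

variable {σ : V → I → Bool}

theorem Btw.symm {x z y : V} (h : Btw σ x z y) : Btw σ y z x := fun i hi => by
  rw [h i hi.symm, hi]

theorem btw_left (x y : V) : Btw σ x x y := fun _ _ => rfl

theorem btw_right (x y : V) : Btw σ x y y := fun _ h => h.symm

theorem Btw.ne {x z y : V} (h : Btw σ x z y) {i : I} (hi : σ z i ≠ σ x i) : σ y i ≠ σ x i :=
  fun h' => hi (h i h'.symm)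

theorem btw_of_ne {x z y : V} (h : ∀ i, σ z i ≠ σ x i → σ y i ≠ σ x i) : Btw σ x z y :=
  fun i hi => by_contra fun h' => h i h' hi.symm

theorem bool_eq_of_ne {a b c : Bool} (h : a ≠ c) (h' : b ≠ c) : a = b := by
  cases a <;> cases b <;> cases c <;> simp_all

theorem Btw.trans_right {x z u y : V} (h : Btw σ x z y) (h' : Btw σ z u y) : Btw σ x u y := by
  intro i hi
  rw [h' i ((h i hi).trans hi), h i hi]

theorem Btw.trans_mid {x z u y : V} (h : Btw σ x z y) (h' : Btw σ z u y) : Btw σ x z u := by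
  intro i hi
  by_contra hne
  have h1 := h.ne hne
  have h2 := bool_eq_of_ne h1 hne
  exact hne ((h' i h2.symm).symm.trans hi.symm)

theorem Btw.mono_right {x v z y : V} (h : Btw σ x v z) (h' : Btw σ x z y) : Btw σ x v y :=
  (h'.symm.trans_right h.symm).symm

theorem Flip.symm {i : I} {u u' : V} (h : Flip σ i u u') : Flip σ i u' u :=
  ⟨h.1.symm, fun j hj => (h.2 j hj).symm⟩

theorem Flip.btw {i : I} {x z y : V} (h : Flip σ i x z) (hi : σ x i ≠ σ y i) : Btw σ x z y := by
  intro j hj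
  by_cases hji : j = i
  · subst hji; exact absurd hj hi
  · exact h.2 j hji

theorem Isometric.eq_of_forall (hσ : Isometric σ) {x y : V} (h : ∀ i, σ x i = σ y i) : x = y := by
  by_contra hne
  obtain ⟨z, i, hi, -⟩ := hσ.step x y hne
  exact hi (h i)

theorem Btw.antisymm (hσ : Isometric σ) {x z y : V} (h : Btw σ x z y) (h' : Btw σ x y z) :
    z = y := by
  refine hσ.eq_of_forall fun i => ?_
  by_cases hz : σ z i = σ x i
  · by_contra hne
    exact h'.ne (fun h'' => hne (hz.trans h''.symm)) hz
  · exact bool_eq_of_ne hz (h.ne hz)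

theorem half_convex (h : I × Bool) : BtwConvex σ (half σ h) := by
  intro x hx y hy z hz
  exact (hz h.1 (hx.trans hy.symm)).trans hx

theorem BtwConvex.inter {C D : Set V} (hC : BtwConvex σ C) (hD : BtwConvex σ D) :
    BtwConvex σ (C ∩ D) :=
  fun x hx y hy z hz => ⟨hC x hx.1 y hy.1 z hz, hD x hx.2 y hy.2 z hz⟩

theorem univ_convex : BtwConvex σ Set.univ := fun _ _ _ _ _ _ => trivial

theorem hull_convex (A : Set V) : BtwConvex σ (hull σ A) :=
  fun x hx y hy z hz C hC => hC.1 x (hx C hC) y (hy C hC) z hz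

theorem subset_hull (A : Set V) : A ⊆ hull σ A := fun _ ha _ hC => hC.2 ha

theorem hull_subset {A C : Set V} (hC : BtwConvex σ C) (h : A ⊆ C) : hull σ A ⊆ C :=
  Set.sInter_subset_of_mem ⟨hC, h⟩

theorem mem_opp {h : I × Bool} {v : V} : v ∈ half σ (opp h) ↔ v ∉ half σ h := by
  change σ v h.1 = !h.2 ↔ ¬ σ v h.1 = h.2
  cases σ v h.1 <;> cases h.2 <;> simp

theorem mem_half_of_ne {h : I × Bool} {u v : V} (hu : u ∈ half σ h) (hv : v ∉ half σ h) {w : V}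
    (hw : σ w h.1 ≠ σ v h.1) : w ∈ half σ h := by
  have : σ u h.1 ≠ σ v h.1 := fun h' => hv (h'.symm.trans hu)
  exact (bool_eq_of_ne hw this).trans hu

theorem Btw.mem_half {h : I × Bool} {x y w : V} (hb : Btw σ x y w) (hx : x ∉ half σ h)
    (hy : y ∈ half σ h) : w ∈ half σ h :=
  mem_half_of_ne hy hx (hb.ne fun h' => hx (h'.symm.trans hy))

theorem Flip.mem_half {i : I} {u u' : V} (hf : Flip σ i u u') {h : I × Bool} (hi : h.1 ≠ i) :
    u' ∈ half σ h ↔ u ∈ half σ h := by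
  simp [half, hf.2 _ hi]

theorem Flip.mem_opp {u u' : V} {h : I × Bool} (hf : Flip σ h.1 u u') (hu : u ∈ half σ h) :
    u' ∉ half σ h := fun h' => hf.1 (h'.trans hu.symm)

theorem exists_front_of_flip {C : Set V} {h : I × Bool} {u u' : V} (hu : u ∈ C) (hu' : u' ∈ C)
    (hf : Flip σ h.1 u u') (huh : u ∈ half σ h) : u ∈ front σ C h ∧ u' ∈ front σ C (opp h) :=
  ⟨⟨hu, huh, u', hu', hf⟩, ⟨hu', CubeLabel.mem_opp.2 (hf.mem_opp huh), u, hu, hf.symm⟩⟩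

/-- A convex set with points on both sides of a half-space contains an edge across it. -/
theorem Isometric.exists_cross (hσ : Isometric σ) {C : Set V} (hC : BtwConvex σ C) {h : I × Bool}
    {x y : V} (hx : x ∈ C) (hxh : x ∈ half σ h) (hy : y ∈ C) (hyh : y ∉ half σ h) :
    ∃ u ∈ C, ∃ u' ∈ C, u ∈ half σ h ∧ u' ∉ half σ h ∧ Flip σ h.1 u u' ∧ Btw σ x u y := by
  induction hn : {i | σ x i ≠ σ y i}.ncard using Nat.strong_induction_on generalizing x with
  | _ n ih =>
    have hne : x ≠ y := fun h' => hyh (h' ▸ hxh)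
    obtain ⟨z, i, hi, hf⟩ := hσ.step x y hne
    have hz : z ∈ C := hC x hx y hy z (hf.btw hi)
    by_cases hih : i = h.1
    · subst hih
      exact ⟨x, hx, z, hz, hxh, hf.mem_opp hxh, hf, btw_left x y⟩
    · have hzh : z ∈ half σ h := (hf.mem_half (Ne.symm hih)).2 hxh
      have hlt : {j | σ z j ≠ σ y j}.ncard < n := by
        rw [← hn]
        refine Set.ncard_lt_ncard ?_ (hσ.finite_diff x y)
        refine ⟨fun j hj => ?_, fun hss => hss hi ?_⟩
        · by_cases hji : j = i
          · subst hji; exact hi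
          · rw [Set.mem_ofPred_eq, ← hf.2 j hji]; exact hj
        · exact bool_eq_of_ne hf.1 hi.symm
      obtain ⟨u, hu, u', hu', h1, h2, h3, h4⟩ := ih _ hlt hz hzh rfl
      exact ⟨u, hu, u', hu', h1, h2, h3, (hf.btw hi).trans_right h4⟩

/-- Convex sets are intersections of half-spaces. -/
theorem Isometric.exists_half (hσ : Isometric σ) {C : Set V} (hC : BtwConvex σ C)
    (hne : C.Nonempty) {x : V} (hx : x ∉ C) : ∃ h, C ⊆ half σ h ∧ x ∉ half σ h := by
  -- For `c` in `C` nearest to `x`, the first step `z` towards `x` leaves `C`. A point of `C` beyond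
  -- the coordinate just changed would put `z` between two points of `C`.
  obtain ⟨c, hc, hmin⟩ : ∃ c ∈ C, ∀ d ∈ C,
      {i | σ c i ≠ σ x i}.ncard ≤ {i | σ d i ≠ σ x i}.ncard :=
    ⟨_, Function.argminOn_mem (fun d => {i | σ d i ≠ σ x i}.ncard) C hne,
      fun _ hd => Function.argminOn_le (fun d => {i | σ d i ≠ σ x i}.ncard) C hd⟩
  obtain ⟨z, i, hi, hf⟩ := hσ.step c x (fun h => hx (h ▸ hc))
  have hz : z ∉ C := by
    intro hz
    refine absurd (hmin z hz) (not_le.2 (Set.ncard_lt_ncard ?_ (hσ.finite_diff c x)))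
    refine ⟨fun j hj => ?_, fun hss => hss hi ?_⟩
    · by_cases hji : j = i
      · subst hji; exact hi
      · rw [Set.mem_ofPred_eq, ← hf.2 j hji]; exact hj
    · exact bool_eq_of_ne hf.1 hi.symm
  refine ⟨(i, σ c i), fun d hd => ?_, hi.symm⟩
  by_contra hd'
  exact hz (hC c hc d hd z (hf.btw (Ne.symm hd')))

/-- Two half-spaces which cut a convex set in the same way are equal. -/
theorem Isometric.half_unique (hσ : Isometric σ) {C : Set V} (hC : BtwConvex σ C)
    {g h : I × Bool} (hgh : ∀ v ∈ C, v ∈ half σ g ↔ v ∈ half σ h) {x y : V} (hx : x ∈ C)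
    (hxh : x ∈ half σ h) (hy : y ∈ C) (hyh : y ∉ half σ h) : g = h := by
  obtain ⟨u, hu, u', hu', h1, h2, h3, -⟩ := hσ.exists_cross hC hx hxh hy hyh
  have hi : g.1 = h.1 := by
    by_contra hne
    exact h2 ((hgh u' hu').1 ((h3.mem_half hne).2 ((hgh u hu).2 h1)))
  refine Prod.ext hi ?_
  have h4 : σ u g.1 = g.2 := (hgh u hu).2 h1
  have h5 : σ u h.1 = h.2 := h1
  rw [← h4, ← h5, hi]

end CubeLabel

/-! ### Critical labellings: maximal quadruples, tight coordinates, antipodes -/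

namespace CubeLabel

variable {V : Type*} {I : Type*}

/-- Four half-spaces with empty intersection, any three of which have a common point. -/
structure IsQuad (σ : V → I → Bool) (a b c d : I × Bool) : Prop where
  empty : ∀ v, v ∈ half σ a → v ∈ half σ b → v ∈ half σ c → v ∈ half σ d → False
  bcd : ∃ v, v ∈ half σ b ∧ v ∈ half σ c ∧ v ∈ half σ d
  acd : ∃ v, v ∈ half σ a ∧ v ∈ half σ c ∧ v ∈ half σ d
  abd : ∃ v, v ∈ half σ a ∧ v ∈ half σ b ∧ v ∈ half σ d
  abc : ∃ v, v ∈ half σ a ∧ v ∈ half σ b ∧ v ∈ half σ c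

/-- All convex sets are stable, and no proper convex set meets the four triple intersections of
four half-spaces with empty intersection. -/
structure IsCritical (σ : V → I → Bool) : Prop where
  isometric : Isometric σ
  stable : ∀ C, BtwConvex σ C → Stable σ C
  minimal : ∀ C, BtwConvex σ C → ∀ a b c d, IsQuad σ a b c d →
    (∃ v ∈ C, v ∈ half σ b ∧ v ∈ half σ c ∧ v ∈ half σ d) →
    (∃ v ∈ C, v ∈ half σ a ∧ v ∈ half σ c ∧ v ∈ half σ d) →
    (∃ v ∈ C, v ∈ half σ a ∧ v ∈ half σ b ∧ v ∈ half σ d) →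
    (∃ v ∈ C, v ∈ half σ a ∧ v ∈ half σ b ∧ v ∈ half σ c) → ∀ v, v ∈ C

/-- Both half-spaces of the coordinate `i` are spanned by their fronts. -/
def Tight (σ : V → I → Bool) (i : I) : Prop :=
  ∀ h : I × Bool, h.1 = i → half σ h ⊆ hull σ (front σ Set.univ h)

/-- A quadruple for which the intersections of the first two and of the last two half-spaces
cannot be enlarged. -/
structure IsMaxQuad (σ : V → I → Bool) (a b c d : I × Bool) : Prop where
  quad : IsQuad σ a b c d
  max_left : ∀ a' b', IsQuad σ a' b' c d → half σ a ∩ half σ b ⊆ half σ a' ∩ half σ b' →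
    half σ a' ∩ half σ b' ⊆ half σ a ∩ half σ b
  max_right : ∀ c' d', IsQuad σ a b c' d' → half σ c ∩ half σ d ⊆ half σ c' ∩ half σ d' →
    half σ c' ∩ half σ d' ⊆ half σ c ∩ half σ d

variable {σ : V → I → Bool} {a b c d : I × Bool}

theorem IsQuad.swap (h : IsQuad σ a b c d) : IsQuad σ b a c d where
  empty v h1 h2 := h.empty v h2 h1
  bcd := h.acd
  acd := h.bcd
  abd := h.abd.imp fun _ h => ⟨h.2.1, h.1, h.2.2⟩
  abc := h.abc.imp fun _ h => ⟨h.2.1, h.1, h.2.2⟩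

theorem IsQuad.symm (h : IsQuad σ a b c d) : IsQuad σ c d a b where
  empty v h1 h2 h3 h4 := h.empty v h3 h4 h1 h2
  bcd := h.abd.imp fun _ h => ⟨h.2.2, h.1, h.2.1⟩
  acd := h.abc.imp fun _ h => ⟨h.2.2, h.1, h.2.1⟩
  abd := h.bcd.imp fun _ h => ⟨h.2.1, h.2.2, h.1⟩
  abc := h.acd.imp fun _ h => ⟨h.2.1, h.2.2, h.1⟩

theorem IsMaxQuad.swap (h : IsMaxQuad σ a b c d) : IsMaxQuad σ b a c d where
  quad := h.quad.swap
  max_left a' b' hq hs := by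
    rw [Set.inter_comm (half σ b)] at hs ⊢
    rw [Set.inter_comm (half σ a')] at hs ⊢
    exact h.max_left b' a' hq.swap hs
  max_right c' d' hq hs := h.max_right c' d' hq.swap hs

theorem IsMaxQuad.symm (h : IsMaxQuad σ a b c d) : IsMaxQuad σ c d a b where
  quad := h.quad.symm
  max_left a' b' hq hs := h.max_right a' b' hq.symm hs
  max_right c' d' hq hs := h.max_left c' d' hq.symm hs

/-- Both intersections are maximised at once in the product order. A half-space separating the
enlarged intersections also separates the original ones. -/
theorem IsQuad.exists_max [Finite V] (h : IsQuad σ a b c d) : ∃ a' b' c' d',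
    IsMaxQuad σ a' b' c' d' ∧ half σ a ∩ half σ b ⊆ half σ a' ∩ half σ b' ∧
      half σ c ∩ half σ d ⊆ half σ c' ∩ half σ d' := by
  obtain ⟨⟨X, Y⟩, hle, ⟨a', b', c', d', hq, hX, hY⟩, hmax⟩ := Finite.exists_le_maximal
    (p := fun P : Set V × Set V => ∃ a' b' c' d', IsQuad σ a' b' c' d' ∧
      P.1 = half σ a' ∩ half σ b' ∧ P.2 = half σ c' ∩ half σ d')
    (a := (half σ a ∩ half σ b, half σ c ∩ half σ d)) ⟨a, b, c, d, h, rfl, rfl⟩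
  simp only at hX hY
  subst hX hY
  refine ⟨a', b', c', d', ⟨hq, fun a'' b'' hq' hs => ?_, fun c'' d'' hq' hs => ?_⟩, hle.1, hle.2⟩
  · exact (@hmax (half σ a'' ∩ half σ b'', half σ c' ∩ half σ d')
      ⟨_, _, _, _, hq', rfl, rfl⟩ ⟨hs, le_rfl⟩).1
  · exact (@hmax (half σ a' ∩ half σ b', half σ c'' ∩ half σ d'')
      ⟨_, _, _, _, hq', rfl, rfl⟩ ⟨le_rfl, hs⟩).2

theorem eq_or_eq_opp {h k : I × Bool} (hi : h.1 = k.1) : h = k ∨ h = opp k := by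
  obtain ⟨i, s⟩ := h
  obtain ⟨j, t⟩ := k
  simp only at hi
  subst hi
  cases s <;> cases t <;> simp [opp]

/-- A point of `D` in `m` but outside `k` would be joined to `z` inside the convex set of points of
`D` outside `k`. The edge where this crosses `m` ends in the front, hence in `k`. -/
theorem Isometric.inter_half_subset (hσ : Isometric σ) {D : Set V} (hD : BtwConvex σ D)
    {m k : I × Bool} (hf : front σ D (opp m) ⊆ half σ k) {z : V} (hz : z ∈ D)
    (hzm : z ∉ half σ m) (hzk : z ∉ half σ k) : D ∩ half σ m ⊆ half σ k := by
  rintro v ⟨hv, hvm⟩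
  by_contra hvk
  obtain ⟨u, hu, u', hu', h1, h2, h3, -⟩ := hσ.exists_cross (hD.inter (half_convex (opp k)))
    ⟨hv, mem_opp.2 hvk⟩ hvm ⟨hz, mem_opp.2 hzk⟩ hzm
  exact mem_opp.1 hu'.2 (hf (exists_front_of_flip hu.1 hu'.1 h3 h1).2)

/-- The hulls of the two fronts of a coordinate together form a convex set. -/
theorem Isometric.union_hull_convex (hσ : Isometric σ) (h : I × Bool) :
    BtwConvex σ (hull σ (front σ Set.univ h) ∪ hull σ (front σ Set.univ (opp h))) := by
  have hsub : ∀ k : I × Bool, hull σ (front σ Set.univ k) ⊆ half σ k := fun k =>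
    hull_subset (half_convex k) fun u hu => hu.2.1
  -- On the way from `z` to `y` the half-space is left at a front point, and `z` lies between `x`
  -- and that point.
  have key : ∀ k : I × Bool, ∀ x ∈ hull σ (front σ Set.univ k), ∀ y ∉ half σ k,
      ∀ z ∈ half σ k, Btw σ x z y → z ∈ hull σ (front σ Set.univ k) := by
    intro k x hx y hy z hz hb
    obtain ⟨u, hu, u', hu', h1, h2, h3, h4⟩ := hσ.exists_cross univ_convex
      (Set.mem_univ z) hz (Set.mem_univ y) hy
    exact hull_convex _ x hx u (subset_hull _ (exists_front_of_flip hu hu' h3 h1).1) z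
      (hb.trans_mid h4)
  intro x hx y hy z hb
  rcases hx with hx | hx <;> rcases hy with hy | hy
  · exact Or.inl (hull_convex _ x hx y hy z hb)
  · by_cases hz : z ∈ half σ h
    · exact Or.inl (key h x hx y (mem_opp.1 (hsub _ hy)) z hz hb)
    · exact Or.inr (key (opp h) y hy x (fun h' => mem_opp.1 h' (hsub _ hx)) z (mem_opp.2 hz)
        hb.symm)
  · by_cases hz : z ∈ half σ h
    · exact Or.inl (key h y hy x (mem_opp.1 (hsub _ hx)) z hz hb.symm)
    · exact Or.inr (key (opp h) x hx y (fun h' => mem_opp.1 h' (hsub _ hy)) z (mem_opp.2 hz) hb)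
  · exact Or.inr (hull_convex _ x hx y hy z hb)

/-- If the half-space `a` of a quadruple cannot be enlarged, then its coordinate is tight. -/
theorem IsCritical.tight_of_saturated (hσ : IsCritical σ) (hq : IsQuad σ a b c d)
    (hs : ∀ g, half σ a ⊆ half σ g →
      (∀ v, v ∈ half σ g → v ∈ half σ b → v ∈ half σ c → v ∈ half σ d → False) →
        half σ g ⊆ half σ a) : Tight σ a.1 := by
  obtain ⟨x₂, hx₂⟩ := hq.acd
  obtain ⟨x₃, hx₃⟩ := hq.abd
  obtain ⟨x₄, hx₄⟩ := hq.abc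
  -- Otherwise some `g` containing `a` and the opposite front misses `p`. If `g` meets `b ∩ c ∩ d`,
  -- minimality forces `p` into `g`; if not, saturation forces the front point `u'` into `a`.
  have hP : ∀ p, p ∈ half σ b → p ∈ half σ c → p ∈ half σ d →
      p ∈ hull σ (front σ Set.univ (opp a)) := by
    intro p hb hc hd
    by_contra hp
    have hpa : p ∉ half σ a := fun h => hq.empty p h hb hc hd
    obtain ⟨u, hu, u', hu', h1, h2, h3, -⟩ := hσ.isometric.exists_cross univ_convex
      (Set.mem_univ x₂) hx₂.1 (Set.mem_univ p) hpa
    have hfr := (exists_front_of_flip hu hu' h3 h1).2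
    obtain ⟨g, hg, hpg⟩ := hσ.isometric.exists_half (hull_convex _)
      ⟨u', subset_hull _ hfr⟩ hp
    have hag : half σ a ⊆ half σ g := by
      have := hσ.isometric.inter_half_subset univ_convex ((subset_hull _).trans hg)
        (Set.mem_univ p) hpa hpg
      rwa [Set.univ_inter] at this
    refine h2 (hs g hag (fun v h1 h2 h3 h4 => hpg ?_) (hg (subset_hull _ hfr)))
    exact hσ.minimal _ (half_convex g) a b c d hq ⟨v, h1, h2, h3, h4⟩ ⟨x₂, hag hx₂.1, hx₂⟩
      ⟨x₃, hag hx₃.1, hx₃⟩ ⟨x₄, hag hx₄.1, hx₄⟩ p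
  obtain ⟨x₁, hb₁, hc₁, hd₁⟩ := hq.bcd
  have ha₁ : x₁ ∉ half σ a := fun h => hq.empty x₁ h hb₁ hc₁ hd₁
  have hF : ∀ g k : I × Bool, x₁ ∈ half σ g → x₁ ∈ half σ k →
      (∃ x, x ∈ half σ a ∧ x ∈ half σ g ∧ x ∈ half σ k) →
      ∃ v ∈ hull σ (front σ Set.univ a) ∪ hull σ (front σ Set.univ (opp a)),
        v ∈ half σ a ∧ v ∈ half σ g ∧ v ∈ half σ k := by
    rintro g k hg hk ⟨x, hxa, hxg, hxk⟩
    obtain ⟨u, hu, u', hu', h1, h2, h3, -⟩ := hσ.isometric.exists_cross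
      ((half_convex g).inter (half_convex k)) ⟨hxg, hxk⟩ hxa ⟨hg, hk⟩ ha₁
    exact ⟨u, Or.inl (subset_hull _ (exists_front_of_flip (Set.mem_univ u) (Set.mem_univ u') h3 h1).1), h1, hu⟩
  -- The union of the two hulls is convex and meets all four triple intersections, so by minimality
  -- it is everything.
  have hJ := hσ.minimal _ (hσ.isometric.union_hull_convex a) a b c d hq
    ⟨x₁, Or.inr (hP x₁ hb₁ hc₁ hd₁), hb₁, hc₁, hd₁⟩ (hF c d hc₁ hd₁ hq.acd)
    (hF b d hb₁ hd₁ hq.abd) (hF b c hb₁ hc₁ hq.abc)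
  have hsub : ∀ k : I × Bool, hull σ (front σ Set.univ k) ⊆ half σ k := fun k =>
    hull_subset (half_convex k) fun u hu => hu.2.1
  intro h hh v hv
  rcases eq_or_eq_opp hh with rfl | rfl
  · exact (hJ v).resolve_right fun h' => mem_opp.1 (hsub _ h') hv
  · exact (hJ v).resolve_left fun h' => mem_opp.1 hv (hsub _ h')

/-- A point that extends `x` maximally differs from `x` in all tight coordinates. -/
theorem IsCritical.ne_of_maximal (hσ : IsCritical σ) {x z : V}
    (hz : ∀ z', Btw σ x z z' → z' = z) {i : I} (hi : Tight σ i) : σ z i ≠ σ x i := by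
  intro h
  -- If `x` and `z` agreed at `i`, stability and maximality would put `z` in the front, and its
  -- neighbour across `i` would extend it further.
  obtain ⟨w, ⟨-, hw, w', -, hf⟩, hb⟩ := hσ.stable _ univ_convex (i, σ x i) x
    (hi (i, σ x i) rfl rfl) z (hi (i, σ x i) rfl h)
  obtain rfl := hz w hb
  refine hf.1 (congrArg (fun v => σ v i) (hz w' ?_))
  exact (hf.symm.btw (y := x) (fun h' => hf.1 (h'.trans h.symm))).symm

theorem Isometric.exists_maximal [Finite V] (hσ : Isometric σ) (x : V) :
    ∃ z, ∀ z', Btw σ x z z' → z' = z := by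
  obtain ⟨_, -, ⟨z, rfl⟩, hmax⟩ := Finite.exists_le_maximal
    (p := fun S : Set V => ∃ z, S = {v | Btw σ x v z}) (a := {v | Btw σ x v x}) ⟨x, rfl⟩
  refine ⟨z, fun z' hz' => ?_⟩
  have h1 : {v | Btw σ x v z} ⊆ {v | Btw σ x v z'} := fun v hv => Btw.mono_right hv hz'
  have h2 : Btw σ x z' z := @hmax _ ⟨z', rfl⟩ h1 z' (btw_right x z')
  exact h2.antisymm hσ hz'

theorem IsCritical.exists_antipode [Finite V] (hσ : IsCritical σ) (x : V) :
    ∃ z, ∀ i, Tight σ i → σ z i ≠ σ x i := by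
  obtain ⟨z, hz⟩ := hσ.isometric.exists_maximal x
  exact ⟨z, fun i hi => hσ.ne_of_maximal hz hi⟩

/-- Stability on the opposite side, applied to the neighbour `x'` of `x` and to a maximal extension
`z`, gives a front point beyond `z`. By maximality it is `z` itself. -/
theorem IsCritical.exists_antipode_front [Finite V] (hσ : IsCritical σ) {h : I × Bool}
    (hh : Tight σ h.1) {x : V} (hx : x ∈ front σ Set.univ h) :
    ∃ z ∈ front σ Set.univ (opp h), ∀ i, Tight σ i → σ z i ≠ σ x i := by
  obtain ⟨z, hz⟩ := hσ.isometric.exists_maximal x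
  refine ⟨z, ?_, fun i hi => hσ.ne_of_maximal hz hi⟩
  obtain ⟨-, hxh, x', -, hf⟩ := hx
  have hxz := hσ.ne_of_maximal hz hh
  have hzo : z ∈ half σ (opp h) := mem_opp.2 fun h' => hxz (h'.trans hxh.symm)
  obtain ⟨w, hw, hb⟩ := hσ.stable _ univ_convex (opp h) x'
    (hh (opp h) rfl (mem_opp.2 (hf.mem_opp hxh))) z (hh (opp h) rfl hzo)
  have hb' : Btw σ x z w := by
    refine btw_of_ne fun j hj => ?_
    by_cases hjh : j = h.1
    · subst hjh
      exact fun h' => mem_opp.1 hw.2.1 (h'.trans hxh)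
    · rw [← hf.2 j hjh] at hj ⊢
      exact hb.ne hj
  rw [← hz w hb']
  exact hw

theorem not_mem_of_ne {h : I × Bool} {x z : V} (hz : σ z h.1 ≠ σ x h.1) (hx : x ∈ half σ h) :
    z ∉ half σ h := fun h' => hz (h'.trans hx.symm)

theorem mem_of_ne {h : I × Bool} {x z : V} (hz : σ z h.1 ≠ σ x h.1) (hx : x ∉ half σ h) :
    z ∈ half σ h := by
  by_contra h'
  exact hz (bool_eq_of_ne h' hx)

/-- Maximality makes `g` and `a` cut the convex set `b` in the same way, and `half_unique` applies.
-/
theorem IsMaxQuad.eq_left (hσ : Isometric σ) (h : IsMaxQuad σ a b c d) {g : I × Bool}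
    (hq : IsQuad σ g b c d) (hs : half σ a ∩ half σ b ⊆ half σ g) : g = a := by
  obtain ⟨x, hxa, hxb, -⟩ := h.quad.abc
  obtain ⟨y, hyb, hyc, hyd⟩ := h.quad.bcd
  have hmax := h.max_left g b hq fun v hv => ⟨hs hv, hv.2⟩
  exact hσ.half_unique (half_convex b) (fun v hv => ⟨fun h' => (hmax ⟨h', hv⟩).1,
    fun h' => hs ⟨h', hv⟩⟩) hxb hxa hyb fun h' => h.quad.empty y h' hyb hyc hyd

theorem IsMaxQuad.eq_right (hσ : Isometric σ) (h : IsMaxQuad σ a b c d) {g : I × Bool}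
    (hq : IsQuad σ a g c d) (hs : half σ a ∩ half σ b ⊆ half σ g) : g = b :=
  h.swap.eq_left hσ hq.swap fun _ hv => hs ⟨hv.2, hv.1⟩

theorem IsCritical.tight_fst (hσ : IsCritical σ) (h : IsMaxQuad σ a b c d) : Tight σ a.1 := by
  refine hσ.tight_of_saturated h.quad fun g hag hg => ?_
  have hq : IsQuad σ g b c d :=
    ⟨hg, h.quad.bcd, h.quad.acd.imp fun _ h => ⟨hag h.1, h.2⟩,
      h.quad.abd.imp fun _ h => ⟨hag h.1, h.2⟩, h.quad.abc.imp fun _ h => ⟨hag h.1, h.2⟩⟩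
  rw [h.eq_left hσ.isometric hq fun v hv => hag hv.1]

/-- A half-space containing `a ∩ b` and meeting `c ∩ d` completes a quadruple with three of
the given half-spaces, unless it contains everything. -/
theorem IsCritical.eq_of_meets (hσ : IsCritical σ) (h : IsMaxQuad σ a b c d) {k : I × Bool}
    (hk : half σ a ∩ half σ b ⊆ half σ k) {p : V} (hp : p ∉ half σ k)
    (hm : ∃ v, v ∈ half σ k ∧ v ∈ half σ c ∧ v ∈ half σ d) : k = a ∨ k = b := by
  obtain ⟨x₃, hx₃⟩ := h.quad.abd
  obtain ⟨x₄, hx₄⟩ := h.quad.abc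
  by_cases h1 : ∃ v ∈ half σ k, v ∈ half σ b ∧ v ∈ half σ c ∧ v ∈ half σ d
  · by_cases h2 : ∃ v ∈ half σ k, v ∈ half σ a ∧ v ∈ half σ c ∧ v ∈ half σ d
    · exact absurd (hσ.minimal _ (half_convex k) a b c d h.quad h1 h2
        ⟨x₃, hk ⟨hx₃.1, hx₃.2.1⟩, hx₃⟩ ⟨x₄, hk ⟨hx₄.1, hx₄.2.1⟩, hx₄⟩ p) hp
    · refine Or.inr (h.eq_right hσ.isometric ⟨fun v ha hk' hc hd => h2 ⟨v, hk', ha, hc, hd⟩, hm,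
        h.quad.acd, ⟨x₃, hx₃.1, hk ⟨hx₃.1, hx₃.2.1⟩, hx₃.2.2⟩,
        ⟨x₄, hx₄.1, hk ⟨hx₄.1, hx₄.2.1⟩, hx₄.2.2⟩⟩ hk)
  · refine Or.inl (h.eq_left hσ.isometric ⟨fun v hk' hb hc hd => h1 ⟨v, hk', hb, hc, hd⟩,
        h.quad.bcd, hm, ⟨x₃, hk ⟨hx₃.1, hx₃.2.1⟩, hx₃.2⟩,
        ⟨x₄, hk ⟨hx₄.1, hx₄.2.1⟩, hx₄.2⟩⟩ hk)

end CubeLabel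

/-! ### Tight half-spaces separating the two pairs of a quadruple -/

namespace CubeLabel

variable {V : Type*} {I : Type*} {σ : V → I → Bool} {a b c d : I × Bool}

/-- `m` separates `a ∩ b` from `c ∩ d`. -/
structure Separates (σ : V → I → Bool) (m a b c d : I × Bool) : Prop where
  left : half σ a ∩ half σ b ⊆ half σ m
  right : ∀ v, v ∈ half σ m → v ∈ half σ c → v ∈ half σ d → False

theorem Separates.symm {m : I × Bool} (h : Separates σ m a b c d) :
    Separates σ (opp m) c d a b where
  left _ hv := mem_opp.2 fun h' => h.right _ h' hv.1 hv.2
  right _ hv h1 h2 := mem_opp.1 hv (h.left ⟨h1, h2⟩)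

/-- Inside `a`, the front facing `b` from outside cannot have the point `p` of `a ∩ c ∩ d` in its
hull. A half-space cutting `p` off from this front is the separator. -/
theorem IsCritical.exists_separates [Finite V] (hσ : IsCritical σ) (h : IsMaxQuad σ a b c d) :
    ∃ m, Separates σ m a b c d := by
  obtain ⟨p, hpa, hpc, hpd⟩ := h.quad.acd
  obtain ⟨q, hqb, hqc, hqd⟩ := h.quad.bcd
  obtain ⟨r, hra, hrb, hrc⟩ := h.quad.abc
  have hpb : p ∉ half σ b := fun h' => h.quad.empty p hpa h' hpc hpd
  have hqa : q ∉ half σ a := fun h' => h.quad.empty q h' hqb hqc hqd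
  have hab : a.1 ≠ b.1 := by
    intro hi
    rcases eq_or_eq_opp hi with h' | h'
    · exact hpb (h' ▸ hpa)
    · exact mem_opp.1 (h' ▸ hra) hrb
  -- an edge across `b` inside `c ∩ d`, and its antipode
  obtain ⟨u, hu, u', hu', h1, h2, h3, -⟩ := hσ.isometric.exists_cross
    ((half_convex c).inter (half_convex d)) ⟨hqc, hqd⟩ hqb ⟨hpc, hpd⟩ hpb
  have hua : u ∉ half σ a := fun h' => h.quad.empty u h' h1 hu.1 hu.2
  have hu0 := (exists_front_of_flip (Set.mem_univ u) (Set.mem_univ u') h3 h1).1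
  obtain ⟨x, hx, hxne⟩ := hσ.exists_antipode_front (hσ.tight_fst h.swap) hu0
  have hxa : x ∈ half σ a := mem_of_ne (hxne _ (hσ.tight_fst h)) hua
  have hxc : x ∉ half σ c := not_mem_of_ne (hxne _ (hσ.tight_fst h.symm)) hu.1
  have hxd : x ∉ half σ d := not_mem_of_ne (hxne _ (hσ.tight_fst h.symm.swap)) hu.2
  have hxF : x ∈ front σ (half σ a) (opp b) := by
    obtain ⟨-, hxb, x', -, hf⟩ := hx
    exact ⟨hxa, hxb, x', (hf.mem_half hab).2 hxa, hf⟩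
  -- Since `x` avoids `c` and `d` while `p` lies in both, a front point `w` beyond `p` lies in both
  -- as well. Its neighbour across `b` would then lie in all four half-spaces.
  have hp : p ∉ hull σ (front σ (half σ a) (opp b)) := by
    intro hp
    obtain ⟨w, ⟨hwa, hwb, w', hw', hf⟩, hb⟩ := hσ.stable _ (half_convex a) (opp b) x
      (subset_hull _ hxF) p hp
    have hwc := hb.mem_half hxc hpc
    have hwd := hb.mem_half hxd hpd
    have hw'b : w' ∈ half σ b := not_not.1 fun h' => hf.mem_opp hwb (mem_opp.2 h')
    have hcb : c.1 ≠ b.1 := by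
      intro hi
      rcases eq_or_eq_opp hi with h' | h'
      · exact hpb (h' ▸ hpc)
      · exact mem_opp.1 (h' ▸ hrc) hrb
    have hdb : d.1 ≠ b.1 := by
      intro hi
      rcases eq_or_eq_opp hi with h' | h'
      · exact hpb (h' ▸ hpd)
      · exact mem_opp.1 (h' ▸ hqd) hqb
    exact h.quad.empty w' hw' hw'b ((hf.mem_half hcb).2 hwc) ((hf.mem_half hdb).2 hwd)
  obtain ⟨m, hm, hpm⟩ := hσ.isometric.exists_half (hull_convex _) ⟨x, subset_hull _ hxF⟩ hp
  have hleft := hσ.isometric.inter_half_subset (half_convex a) ((subset_hull _).trans hm) hpa hpb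
    hpm
  refine ⟨m, hleft, fun v hvm hvc hvd => ?_⟩
  rcases hσ.eq_of_meets h hleft hpm ⟨v, hvm, hvc, hvd⟩ with rfl | rfl
  · exact hpm hpa
  · exact mem_opp.1 hx.2.1 (hm (subset_hull _ hxF))

/-- The complement of a maximal separating half-space is spanned by its front. -/
theorem IsCritical.opp_subset_hull (hσ : IsCritical σ) (h : IsMaxQuad σ a b c d) {m : I × Bool}
    (hm : Separates σ m a b c d)
    (hmax : ∀ k, Separates σ k a b c d → half σ m ⊆ half σ k → half σ k ⊆ half σ m) :
    half σ (opp m) ⊆ hull σ (front σ Set.univ (opp m)) := by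
  obtain ⟨p, hpa, hpc, hpd⟩ := h.quad.acd
  obtain ⟨q, hqb, hqc, hqd⟩ := h.quad.bcd
  obtain ⟨s, hsa, hsb, hsd⟩ := h.quad.abd
  obtain ⟨r, hra, hrb, hrc⟩ := h.quad.abc
  have hpm : p ∉ half σ m := fun h' => hm.right p h' hpc hpd
  have hrm := hm.left ⟨hra, hrb⟩
  obtain ⟨u, hu, u', hu', h1, h2, h3, -⟩ := hσ.isometric.exists_cross univ_convex
    (Set.mem_univ r) hrm (Set.mem_univ p) hpm
  have hfr := (exists_front_of_flip hu hu' h3 h1).2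
  have key : ∀ z, z ∉ half σ m → z ∉ hull σ (front σ Set.univ (opp m)) →
      ∃ k, hull σ (front σ Set.univ (opp m)) ⊆ half σ k ∧ half σ m ⊆ half σ k ∧
        z ∉ half σ k := by
    intro z hzm hz
    obtain ⟨k, hk, hzk⟩ := hσ.isometric.exists_half (hull_convex _) ⟨u', subset_hull _ hfr⟩ hz
    have := hσ.isometric.inter_half_subset univ_convex ((subset_hull _).trans hk)
      (Set.mem_univ z) hzm hzk
    rw [Set.univ_inter] at this
    exact ⟨k, hk, this, hzk⟩
  -- A missed point gives a half-space `k` strictly larger than `m`. It separates too, against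
  -- maximality, or it is `a` or `b`; then `m` cuts the other one of these exactly as `k` does, so
  -- `m = k`.
  have hcd : ∀ z, z ∈ half σ c → z ∈ half σ d → z ∈ hull σ (front σ Set.univ (opp m)) := by
    intro z hzc hzd
    by_contra hz
    obtain ⟨k, hk, hmk, hzk⟩ := key z (fun h' => hm.right z h' hzc hzd) hz
    have hk' := hm.left.trans hmk
    have hks : ¬ half σ k ⊆ half σ m := fun h' => h2 (h' (hk (subset_hull _ hfr)))
    by_cases hmeet : ∃ v, v ∈ half σ k ∧ v ∈ half σ c ∧ v ∈ half σ d
    · rcases hσ.eq_of_meets h hk' hzk hmeet with rfl | rfl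
      · have : m = k := hσ.isometric.half_unique (half_convex b)
          (fun v hv => ⟨fun h' => hmk h', fun h' => hm.left ⟨h', hv⟩⟩) hrb hra hqb
          fun h' => h.quad.empty q h' hqb hqc hqd
        exact hks (this ▸ le_rfl)
      · have : m = k := hσ.isometric.half_unique (half_convex a)
          (fun v hv => ⟨fun h' => hmk h', fun h' => hm.left ⟨hv, h'⟩⟩) hra hrb hpa
          fun h' => h.quad.empty p hpa h' hpc hpd
        exact hks (this ▸ le_rfl)
    · exact hks (hmax k ⟨hk', fun v h1 h2 h3 => hmeet ⟨v, h1, h2, h3⟩⟩ hmk)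
  intro z hz
  by_contra hzh
  obtain ⟨k, hk, hmk, hzk⟩ := key z (mem_opp.1 hz) hzh
  exact hzk (hσ.minimal _ (half_convex k) a b c d h.quad
    ⟨q, hk (hcd q hqc hqd), hqb, hqc, hqd⟩ ⟨p, hk (hcd p hpc hpd), hpa, hpc, hpd⟩
    ⟨s, hmk (hm.left ⟨hsa, hsb⟩), hsa, hsb, hsd⟩ ⟨r, hmk hrm, hra, hrb, hrc⟩ z)

/-- For nested separating half-spaces, the strip between them is empty if it contains the
front of the larger one. -/
theorem IsCritical.false_of_strip [Finite V] (hσ : IsCritical σ) (h : IsMaxQuad σ a b c d)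
    {m : I × Bool} (hm : Separates σ m a b c d) {D : Set V} (hD : BtwConvex σ D)
    (hfront : front σ Set.univ m ⊆ D)
    (hab : ∀ v ∈ D, v ∈ half σ a → v ∈ half σ b → False)
    (hcd : ∀ v ∈ D, v ∈ half σ c → v ∈ half σ d → False) : False := by
  have hopp : ∀ v, v ∉ half σ a → v ∉ half σ b → v ∉ half σ c → v ∉ half σ d → False := by
    intro v h1 h2 h3 h4
    obtain ⟨z, hz⟩ := hσ.exists_antipode v
    exact h.quad.empty z (mem_of_ne (hz _ (hσ.tight_fst h)) h1)
      (mem_of_ne (hz _ (hσ.tight_fst h.swap)) h2) (mem_of_ne (hz _ (hσ.tight_fst h.symm)) h3)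
      (mem_of_ne (hz _ (hσ.tight_fst h.symm.swap)) h4)
  -- Crossing `m` inside `g ∩ k` gives a point of the front of `m`, which lies in `D`.
  have corner : ∀ g k : I × Bool, (∃ v, v ∈ half σ a ∧ v ∈ half σ b ∧ v ∈ half σ g ∩ half σ k) →
      (∃ v, v ∈ half σ c ∧ v ∈ half σ d ∧ v ∈ half σ g ∩ half σ k) →
      ∃ u ∈ D, u ∈ half σ g ∩ half σ k := by
    rintro g k ⟨x, hxa, hxb, hx⟩ ⟨y, hyc, hyd, hy⟩
    obtain ⟨u, hu, u', hu', h1, h2, h3, -⟩ := hσ.isometric.exists_cross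
      ((half_convex g).inter (half_convex k)) hx (hm.left ⟨hxa, hxb⟩) hy
      fun h' => hm.right y h' hyc hyd
    exact ⟨u, hfront (exists_front_of_flip (Set.mem_univ u) (Set.mem_univ u') h3 h1).1, hu⟩
  have hne : c.1 ≠ d.1 := by
    intro hi
    rcases eq_or_eq_opp hi with rfl | rfl
    · obtain ⟨v, h1, h2, h3⟩ := h.quad.abd
      exact h.quad.empty v h1 h2 h3 h3
    · obtain ⟨v, h1, h2, h3⟩ := h.quad.acd
      exact mem_opp.1 h2 h3
  have hne' : a.1 ≠ b.1 := by
    intro hi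
    rcases eq_or_eq_opp hi with rfl | rfl
    · obtain ⟨v, h1, h2, h3⟩ := h.quad.acd
      exact h.quad.empty v h1 h1 h2 h3
    · obtain ⟨v, h1, h2, h3⟩ := h.quad.abc
      exact mem_opp.1 h1 h2
  -- In `D` the half-spaces `c` and `d` are disjoint, so the edge leaving `c` towards `d` ends
  -- outside both. The same move from `a` to `b` then produces a point outside all four,
  -- contradicting `hopp`.
  have side : ∀ g : I × Bool, (∃ u ∈ D, u ∈ half σ g ∩ half σ c) →
      (∃ u ∈ D, u ∈ half σ g ∩ half σ d) →
      ∃ u ∈ D, u ∈ half σ g ∧ u ∉ half σ c ∧ u ∉ half σ d := by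
    rintro g ⟨x, hxD, hx⟩ ⟨y, hyD, hy⟩
    obtain ⟨u, hu, u', hu', h1, h2, h3, -⟩ := hσ.isometric.exists_cross
      (hD.inter (half_convex g)) ⟨hxD, hx.1⟩ hx.2 ⟨hyD, hy.1⟩ fun h' => hcd y hyD h' hy.2
    exact ⟨u', hu'.1, hu'.2, h2, fun h' => hcd u hu.1 h1 ((h3.mem_half hne.symm).1 h')⟩
  obtain ⟨va, hva⟩ := h.quad.acd
  obtain ⟨vb, hvb⟩ := h.quad.bcd
  obtain ⟨vc, hvc⟩ := h.quad.abc
  obtain ⟨vd, hvd⟩ := h.quad.abd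
  obtain ⟨x, hxD, hxa, hxc, hxd⟩ := side a
    (corner a c ⟨vc, hvc.1, hvc.2.1, hvc.1, hvc.2.2⟩ ⟨va, hva.2.1, hva.2.2, hva.1, hva.2.1⟩)
    (corner a d ⟨vd, hvd.1, hvd.2.1, hvd.1, hvd.2.2⟩ ⟨va, hva.2.1, hva.2.2, hva.1, hva.2.2⟩)
  obtain ⟨y, hyD, hyb, hyc, hyd⟩ := side b
    (corner b c ⟨vc, hvc.1, hvc.2.1, hvc.2.1, hvc.2.2⟩ ⟨vb, hvb.2.1, hvb.2.2, hvb.1, hvb.2.1⟩)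
    (corner b d ⟨vd, hvd.1, hvd.2.1, hvd.2.1, hvd.2.2⟩ ⟨vb, hvb.2.1, hvb.2.2, hvb.1, hvb.2.2⟩)
  obtain ⟨u, hu, u', hu', h1, h2, h3, -⟩ := hσ.isometric.exists_cross
    (hD.inter ((half_convex (opp c)).inter (half_convex (opp d))))
    ⟨hxD, mem_opp.2 hxc, mem_opp.2 hxd⟩ hxa ⟨hyD, mem_opp.2 hyc, mem_opp.2 hyd⟩
    fun h' => hab y hyD h' hyb
  exact hopp u' h2 (fun h' => hab u hu.1 h1 ((h3.mem_half hne'.symm).1 h'))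
    (mem_opp.1 hu'.2.1) (mem_opp.1 hu'.2.2)

/-- The intersections of the two pairs of a quadruple are separated by a tight half-space. -/
theorem IsCritical.exists_tight_separates [Finite V] (hσ : IsCritical σ)
    (hq : IsQuad σ a b c d) : ∃ m, Tight σ m.1 ∧ Separates σ m a b c d := by
  obtain ⟨a', b', c', d', h, hab, hcd⟩ := hq.exists_max
  suffices ∃ m, Tight σ m.1 ∧ Separates σ m a' b' c' d' by
    obtain ⟨m, ht, hm⟩ := this
    exact ⟨m, ht, hab.trans hm.left, fun v hv h1 h2 =>
      hm.right v hv (hcd ⟨h1, h2⟩).1 (hcd ⟨h1, h2⟩).2⟩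
  clear hab hcd hq
  obtain ⟨m₀, hm₀⟩ := hσ.exists_separates h
  obtain ⟨_, -, ⟨m, rfl, hm⟩, hmax⟩ := Finite.exists_le_maximal
    (p := fun S : Set V => ∃ m, S = half σ m ∧ Separates σ m a' b' c' d')
    (a := half σ m₀) ⟨m₀, rfl, hm₀⟩
  -- The complements of `m` and `n` are both spanned by their fronts. If `m` is the complement of
  -- `n`, its coordinate is tight; otherwise the strip `m ∩ n` is impossible by `false_of_strip`.
  obtain ⟨_, hle, ⟨n, rfl, hn⟩, hnmax⟩ := Finite.exists_le_maximal
    (p := fun S : Set V => ∃ n, S = half σ n ∧ Separates σ n c' d' a' b')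
    (a := half σ (opp m)) ⟨opp m, rfl, hm.symm⟩
  have h1 := hσ.opp_subset_hull h hm fun k hk hmk => @hmax _ ⟨k, rfl, hk⟩ hmk
  have h2 := hσ.opp_subset_hull h.symm hn fun k hk hnk => @hnmax _ ⟨k, rfl, hk⟩ hnk
  by_cases hmn : m.1 = n.1
  · have hmn' : m = opp n := by
      rcases eq_or_eq_opp hmn with rfl | rfl
      · obtain ⟨v, hva, hvb, hvc⟩ := h.quad.abc
        exact absurd (hm.left ⟨hva, hvb⟩) fun h' => hn.right v h' hva hvb
      · rfl
    refine ⟨m, fun k hk => ?_, hm⟩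
    rcases eq_or_eq_opp hk with rfl | rfl
    · rwa [hmn']
    · exact h1
  · refine (hσ.false_of_strip h hm ((half_convex m).inter (half_convex n)) ?_
      (fun v hv h1 h2 => hn.right v hv.2 h1 h2) (fun v hv h1 h2 => hm.right v hv.1 h1 h2)).elim
    rintro u ⟨-, hum, u', -, hf⟩
    exact ⟨hum, (hf.mem_half (Ne.symm hmn)).1 (hle (mem_opp.2 (hf.mem_opp hum)))⟩

/-! ### Concurrency of tight coordinates and the descent -/

/-- Some octant of the three coordinates is empty. -/
def Concurrent (σ : V → I → Bool) (i j k : I) : Prop :=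
  ∃ p q r : Bool, ∀ v, σ v i = p → σ v j = q → σ v k = r → False

theorem Concurrent.rotate {i j k : I} (h : Concurrent σ i j k) : Concurrent σ j k i := by
  obtain ⟨p, q, r, h⟩ := h
  exact ⟨q, r, p, fun v h1 h2 h3 => h v h3 h1 h2⟩

theorem Concurrent.swap {i j k : I} (h : Concurrent σ i j k) : Concurrent σ i k j := by
  obtain ⟨p, q, r, h⟩ := h
  exact ⟨p, r, q, fun v h1 h2 h3 => h v h1 h3 h2⟩

theorem concurrent_of_half {g h k : I × Bool}
    (he : ∀ v, v ∈ half σ g → v ∈ half σ h → v ∈ half σ k → False) :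
    Concurrent σ g.1 h.1 k.1 :=
  ⟨_, _, _, he⟩

theorem exists_of_not_concurrent {i j k : I} (h : ¬ Concurrent σ i j k) (p q r : Bool) :
    ∃ v, σ v i = p ∧ σ v j = q ∧ σ v k = r := by
  by_contra h'
  exact h ⟨p, q, r, fun v h1 h2 h3 => h' ⟨v, h1, h2, h3⟩⟩

theorem eq_of_ne_of_eq_not {s t p : Bool} (h : s ≠ t) (ht : t = !p) : s = p := by
  cases s <;> cases p <;> simp_all

theorem eq_xor_of_not {q r s t : Bool} (h1 : ¬ (s = q ∧ t = r)) (h2 : ¬ (s = (!q) ∧ t = (!r))) :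
    t = xor (xor q (!r)) s := by
  revert q r s t
  decide

/-- Concurrency at a tight coordinate means that the two other coordinates agree on the
front, up to a sign. -/
theorem IsCritical.xor_of_concurrent [Finite V] (hσ : IsCritical σ) {i j k : I} (hi : Tight σ i)
    (hj : Tight σ j) (hk : Tight σ k) (hji : j ≠ i) (hki : k ≠ i) (hc : Concurrent σ i j k) :
    ∃ e : Bool, ∀ u ∈ front σ Set.univ (i, true), σ u k = xor e (σ u j) := by
  have hanti : ∀ p q r : Bool, (∀ v, σ v i = p → σ v j = q → σ v k = r → False) →
      ∀ v, σ v i = !p → σ v j = !q → σ v k = !r → False := by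
    intro p q r h v h1 h2 h3
    obtain ⟨z, hz⟩ := hσ.exists_antipode v
    exact h z (eq_of_ne_of_eq_not (hz i hi) h1) (eq_of_ne_of_eq_not (hz j hj) h2)
      (eq_of_ne_of_eq_not (hz k hk) h3)
  obtain ⟨q, r, h⟩ : ∃ q r : Bool, ∀ v, σ v i = true → σ v j = q → σ v k = r → False := by
    obtain ⟨p, q, r, h⟩ := hc
    cases p
    · exact ⟨!q, !r, hanti _ _ _ h⟩
    · exact ⟨q, r, h⟩
  refine ⟨xor q (!r), fun u hu => ?_⟩
  have h1 := h u hu.2.1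
  -- A front point in the opposite quadrant has an antipode in the other front, whose neighbour
  -- across `i` would lie in the empty octant.
  have h2 : ¬ (σ u j = (!q) ∧ σ u k = (!r)) := by
    rintro ⟨h3, h4⟩
    obtain ⟨z, ⟨-, hzi, z', -, hf⟩, hz⟩ := hσ.exists_antipode_front hi hu
    exact h z' (eq_of_ne_of_eq_not hf.1 hzi)
      ((hf.2 j hji).trans (eq_of_ne_of_eq_not (hz j hj) h3))
      ((hf.2 k hki).trans (eq_of_ne_of_eq_not (hz k hk) h4))
  exact eq_xor_of_not (fun h3 => h1 h3.1 h3.2) h2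

/-- On the front of `i` both `k` and `l` agree with `j` up to sign, hence with each other. If every
octant were inhabited, two points with opposite labels at `k` and `l`, both violating this relation,
would by stability yield a front point violating it. -/
theorem IsCritical.concurrent_trans [Finite V] (hσ : IsCritical σ) {i j k l : I} (hi : Tight σ i)
    (hj : Tight σ j) (hk : Tight σ k) (hl : Tight σ l) (hji : j ≠ i)
    (h : Concurrent σ i j k) (h' : Concurrent σ i j l) : Concurrent σ i k l := by
  by_cases hki : k = i
  · subst hki
    exact ⟨true, false, true, fun v h1 h2 _ => by simp [h1] at h2⟩
  by_cases hli : l = i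
  · subst hli
    exact ⟨true, false, false, fun v h1 _ h2 => by simp [h1] at h2⟩
  obtain ⟨e, he⟩ := hσ.xor_of_concurrent hi hj hk hji hki h
  obtain ⟨e', he'⟩ := hσ.xor_of_concurrent hi hj hl hji hli h'
  by_contra hc
  obtain ⟨x, hxi, hxk, hxl⟩ := exists_of_not_concurrent hc true false (!(xor e e'))
  obtain ⟨y, hyi, hyk, hyl⟩ := exists_of_not_concurrent hc true true (xor e e')
  obtain ⟨w, hw, hb⟩ := hσ.stable _ univ_convex (i, true) x (hi (i, true) rfl hxi) y
    (hi (i, true) rfl hyi)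
  have h1 := he w hw
  have h2 := he' w hw
  have h3 : σ w k ≠ σ x k := hb.ne (by simp [hxk, hyk])
  have h4 : σ w l ≠ σ x l := hb.ne (by simp [hxl, hyl])
  rw [hxk] at h3
  rw [hxl] at h4
  cases e <;> cases e' <;> cases hj' : σ w j <;> simp_all

/-- A quadruple of half-spaces with tight coordinates. -/
structure IsTightQuad (σ : V → I → Bool) (a b c d : I × Bool) : Prop extends
    IsQuad σ a b c d where
  tight_a : Tight σ a.1
  tight_b : Tight σ b.1
  tight_c : Tight σ c.1
  tight_d : Tight σ d.1

theorem IsTightQuad.symm (h : IsTightQuad σ a b c d) : IsTightQuad σ c d a b :=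
  ⟨h.toIsQuad.symm, h.tight_c, h.tight_d, h.tight_a, h.tight_b⟩

theorem IsTightQuad.swap (h : IsTightQuad σ a b c d) : IsTightQuad σ b a c d :=
  ⟨h.toIsQuad.swap, h.tight_b, h.tight_a, h.tight_c, h.tight_d⟩

theorem IsCritical.antipodal [Finite V] (hσ : IsCritical σ) {g h k : I × Bool}
    (hg : Tight σ g.1) (hh : Tight σ h.1) (hk : Tight σ k.1)
    (he : ∀ v, v ∈ half σ g → v ∈ half σ h → v ∈ half σ k → False) (v : V)
    (h1 : v ∉ half σ g) (h2 : v ∉ half σ h) (h3 : v ∉ half σ k) : False := by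
  obtain ⟨z, hz⟩ := hσ.exists_antipode v
  exact he z (mem_of_ne (hz _ hg) h1) (mem_of_ne (hz _ hh) h2) (mem_of_ne (hz _ hk) h3)

theorem exists_half_of_not_concurrent {g h k : I × Bool} (hc : ¬ Concurrent σ g.1 h.1 k.1) :
    ∃ v, v ∈ half σ g ∧ v ∈ half σ h ∧ v ∈ half σ k :=
  exists_of_not_concurrent hc _ _ _

theorem bool_eq_iff (s t p : Bool) : s = t ↔ (s = p ↔ t = p) := by
  cases s <;> cases t <;> cases p <;> simp

/-- An empty octant has an empty antipodal octant. The four witnesses of the quadruple occupy one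
octant from each of the four antipodal pairs. -/
theorem IsTightQuad.not_concurrent [Finite V] (hσ : IsCritical σ) (h : IsTightQuad σ a b c d) :
    ¬ Concurrent σ a.1 b.1 c.1 := by
  rintro ⟨p, q, r, he⟩
  obtain ⟨v₁, hv₁⟩ := h.bcd
  obtain ⟨v₂, hv₂⟩ := h.acd
  obtain ⟨v₃, hv₃⟩ := h.abd
  obtain ⟨v₄, hv₄⟩ := h.abc
  have h1 : v₁ ∉ half σ a := fun h' => h.empty v₁ h' hv₁.1 hv₁.2.1 hv₁.2.2
  have h2 : v₂ ∉ half σ b := fun h' => h.empty v₂ hv₂.1 h' hv₂.2.1 hv₂.2.2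
  have h3 : v₃ ∉ half σ c := fun h' => h.empty v₃ hv₃.1 hv₃.2.1 h' hv₃.2.2
  have key' : ∀ v, ¬ σ v a.1 = p → ¬ σ v b.1 = q → ¬ σ v c.1 = r → False :=
    hσ.antipodal (g := (a.1, p)) (h := (b.1, q)) (k := (c.1, r)) h.tight_a h.tight_b h.tight_c he
  have mem : ∀ v, (v ∈ half σ a ↔ (σ v a.1 = p ↔ a.2 = p)) ∧
      (v ∈ half σ b ↔ (σ v b.1 = q ↔ b.2 = q)) ∧ (v ∈ half σ c ↔ (σ v c.1 = r ↔ c.2 = r)) :=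
    fun v => ⟨bool_eq_iff _ _ _, bool_eq_iff _ _ _, bool_eq_iff _ _ _⟩
  have m₁ := And.intro ((mem v₁).1.not.1 h1) (And.intro ((mem v₁).2.1.1 hv₁.1)
    ((mem v₁).2.2.1 hv₁.2.1))
  have m₂ := And.intro ((mem v₂).1.1 hv₂.1) (And.intro ((mem v₂).2.1.not.1 h2)
    ((mem v₂).2.2.1 hv₂.2.1))
  have m₃ := And.intro ((mem v₃).1.1 hv₃.1) (And.intro ((mem v₃).2.1.1 hv₃.2.1)
    ((mem v₃).2.2.not.1 h3))
  have m₄ := And.intro ((mem v₄).1.1 hv₄.1) (And.intro ((mem v₄).2.1.1 hv₄.2.1)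
    ((mem v₄).2.2.1 hv₄.2.2))
  clear mem hv₁ hv₂ hv₃ hv₄ h1 h2 h3
  by_cases ha : a.2 = p <;> by_cases hb : b.2 = q <;> by_cases hc : c.2 = r <;>
    simp only [ha, hb, hc, iff_true, iff_false, not_not] at m₁ m₂ m₃ m₄
  · exact he _ m₄.1 m₄.2.1 m₄.2.2
  · exact he _ m₃.1 m₃.2.1 m₃.2.2
  · exact he _ m₂.1 m₂.2.1 m₂.2.2
  · exact key' _ m₁.1 m₁.2.1 m₁.2.2
  · exact he _ m₁.1 m₁.2.1 m₁.2.2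
  · exact key' _ m₂.1 m₂.2.1 m₂.2.2
  · exact key' _ m₃.1 m₃.2.1 m₃.2.2
  · exact key' _ m₄.1 m₄.2.1 m₄.2.2

theorem IsTightQuad.swap_mid (h : IsTightQuad σ a b c d) : IsTightQuad σ a c b d where
  empty v h1 h2 h3 := h.empty v h1 h3 h2
  bcd := h.bcd.imp fun _ h => ⟨h.2.1, h.1, h.2.2⟩
  acd := h.abd
  abd := h.acd
  abc := h.abc.imp fun _ h => ⟨h.1, h.2.2, h.2.1⟩
  tight_a := h.tight_a
  tight_b := h.tight_c
  tight_c := h.tight_b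
  tight_d := h.tight_d

theorem IsTightQuad.swap_last (h : IsTightQuad σ a b c d) : IsTightQuad σ a b d c :=
  h.symm.swap.symm

theorem fst_ne {g h : I × Bool} (h1 : g ≠ h) (h2 : g ≠ opp h) : g.1 ≠ h.1 := fun hi =>
  (eq_or_eq_opp hi).elim h1 h2

/-- The coordinate of a separating half-space is different from those of the quadruple. -/
theorem Separates.fst_ne_right {m : I × Bool} (hm : Separates σ m a b c d)
    (hq : IsQuad σ a b c d) : m.1 ≠ c.1 := by
  refine fst_ne ?_ ?_
  · rintro rfl
    obtain ⟨v, -, h1, h2⟩ := hq.bcd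
    exact hm.right v h1 h1 h2
  · rintro rfl
    obtain ⟨v, h1, h2, h3⟩ := hq.abc
    exact mem_opp.1 (hm.left ⟨h1, h2⟩) h3

theorem Separates.fst_ne_left {m : I × Bool} (hm : Separates σ m a b c d)
    (hq : IsQuad σ a b c d) : m.1 ≠ a.1 :=
  hm.symm.fst_ne_right hq.symm

theorem Separates.swap_left {m : I × Bool} (hm : Separates σ m a b c d) :
    Separates σ m b a c d :=
  ⟨fun _ hv => hm.left hv.symm, hm.right⟩

theorem Separates.swap_right {m : I × Bool} (hm : Separates σ m a b c d) :
    Separates σ m a b d c :=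
  ⟨hm.left, fun v h h1 h2 => hm.right v h h2 h1⟩

theorem Separates.concurrent_right {m : I × Bool} (hm : Separates σ m a b c d) :
    Concurrent σ c.1 d.1 m.1 :=
  concurrent_of_half (g := c) (h := d) (k := m) fun v h1 h2 h => hm.right v h h1 h2

theorem Separates.concurrent_left {m : I × Bool} (hm : Separates σ m a b c d) :
    Concurrent σ a.1 b.1 m.1 :=
  hm.symm.concurrent_right

/-- A tight quadruple can be replaced by one with a smaller triple intersection. -/
theorem IsCritical.exists_smaller [Finite V] (hσ : IsCritical σ) {l : I × Bool}
    (h : IsTightQuad σ l a b c) : ∃ l' m, IsTightQuad σ l' a b m ∧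
      half σ a ∩ half σ b ∩ half σ m ⊂ half σ a ∩ half σ b ∩ half σ c := by
  have tl := h.tight_a
  have ta := h.tight_b
  have tb := h.tight_c
  have tc := h.tight_d
  have hlab : ¬ Concurrent σ l.1 a.1 b.1 := h.not_concurrent hσ
  have hbcl : ¬ Concurrent σ b.1 c.1 l.1 := h.symm.not_concurrent hσ
  have hcbl : ¬ Concurrent σ c.1 b.1 l.1 := h.symm.swap.not_concurrent hσ
  have hcla : ¬ Concurrent σ c.1 l.1 a.1 :=
    h.symm.swap.swap_mid.swap_last.not_concurrent hσ
  have habc : ¬ Concurrent σ a.1 b.1 c.1 := h.swap.swap_mid.swap_last.not_concurrent hσ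
  have hq₁ : IsTightQuad σ l b a c := h.swap_mid
  have hq₂ : IsTightQuad σ l c a b := h.symm.swap.swap_mid.swap_last.swap
  -- In the quadrilateral with sides `l`, `a`, `b`, `c`, the line `e` joins `l ∩ b` to `a ∩ c`, and
  -- `f` joins `l ∩ c` to `a ∩ b`. The later `m` joins `b ∩ c` to the diagonal point `e ∩ f`.
  obtain ⟨e, te, he⟩ := hσ.exists_tight_separates hq₁.toIsQuad
  obtain ⟨f, tf, hf⟩ := hσ.exists_tight_separates hq₂.toIsQuad
  have heb : e.1 ≠ b.1 := he.swap_left.fst_ne_left hq₁.swap.toIsQuad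
  have hea : e.1 ≠ a.1 := he.fst_ne_right hq₁.toIsQuad
  have hec : e.1 ≠ c.1 := he.swap_right.fst_ne_right hq₁.symm.swap.symm.toIsQuad
  have hfc : f.1 ≠ c.1 := hf.swap_left.fst_ne_left hq₂.swap.toIsQuad
  have hfb : f.1 ≠ b.1 := hf.swap_right.fst_ne_right hq₂.symm.swap.symm.toIsQuad
  have lbe := he.concurrent_left
  have ace := he.concurrent_right
  have lcf := hf.concurrent_left
  have abf := hf.concurrent_right
  have bce : ¬ Concurrent σ b.1 c.1 e.1 := fun h' => hbcl
    (hσ.concurrent_trans tb te tc tl heb h'.swap lbe.rotate)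
  have bcf : ¬ Concurrent σ b.1 c.1 f.1 := fun h' => hcbl
    (hσ.concurrent_trans tc tf tb tl hfc h'.rotate lcf.rotate)
  have bef : ¬ Concurrent σ b.1 e.1 f.1 := fun h' => hlab
    (hσ.concurrent_trans tb te tl ta heb lbe.rotate
      (hσ.concurrent_trans tb tf te ta hfb h'.swap abf.rotate)).rotate
  have cef : ¬ Concurrent σ c.1 e.1 f.1 := fun h' => hcla
    (hσ.concurrent_trans tc tf tl ta hfc lcf.rotate
      (hσ.concurrent_trans tc te tf ta hec h' ace.rotate))
  -- the second quadruple
  have hq₃ : IsTightQuad σ (opp b) c e (opp f) :=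
    { empty := fun v h1 h2 h3 h4 => by
        have hva : v ∉ half σ a := fun h' => he.right v h3 h' h2
        exact hσ.antipodal ta tb tf (fun v h1 h2 h3 => hf.right v h3 h1 h2) v hva
          (mem_opp.1 h1) (mem_opp.1 h4)
      bcd := exists_half_of_not_concurrent (k := opp f) cef
      acd := exists_half_of_not_concurrent (g := opp b) (k := opp f) bef
      abd := exists_half_of_not_concurrent (g := opp b) (k := opp f) bcf
      abc := exists_half_of_not_concurrent (g := opp b) bce
      tight_a := tb
      tight_b := tc
      tight_c := te
      tight_d := tf }
  obtain ⟨m, tm, hm⟩ := hσ.exists_tight_separates hq₃.toIsQuad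
  have hmb : m.1 ≠ b.1 := hm.fst_ne_left hq₃.toIsQuad
  have hmc : m.1 ≠ c.1 := hm.swap_left.fst_ne_left hq₃.swap.toIsQuad
  have bcm : Concurrent σ b.1 c.1 m.1 := hm.concurrent_left
  have abm : ¬ Concurrent σ a.1 b.1 m.1 := fun h' => habc
    (hσ.concurrent_trans tb tm ta tc hmb h'.rotate bcm.swap).rotate.swap
  have abe : ¬ Concurrent σ a.1 b.1 e.1 := fun h' => hlab
    (hσ.concurrent_trans tb te tl ta heb lbe.rotate h'.rotate).rotate
  have bme : ¬ Concurrent σ b.1 m.1 e.1 := fun h' => bce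
    (hσ.concurrent_trans tb tm tc te hmb bcm.swap h')
  have acm : ¬ Concurrent σ a.1 c.1 m.1 := fun h' => habc
    (hσ.concurrent_trans tc tm ta tb hmc h'.rotate bcm.rotate).rotate
  have ame : ¬ Concurrent σ a.1 m.1 e.1 := fun h' => acm
    (hσ.concurrent_trans ta te tc tm hea ace.swap h'.swap)
  -- This octant is antipodal to the one emptied by the choice of `m`, so `m` and `b` together force
  -- `c`. That gives the inclusion of triple intersections.
  have hopp : ∀ v, v ∈ half σ b → v ∉ half σ c → v ∈ half σ m → False := fun v h1 h2 h3 =>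
    hσ.antipodal (g := opp b) (h := c) (k := opp m) tb tc tm
      (fun v h1 h2 h3 => mem_opp.1 h3 (hm.left ⟨h1, h2⟩)) v (fun h' => mem_opp.1 h' h1) h2
      fun h' => mem_opp.1 h' h3
  refine ⟨e, m, ⟨⟨fun v h1 h2 h3 h4 => hopp v h3 (fun h' => he.right v h1 h2 h') h4,
    exists_half_of_not_concurrent abm, ?_, ?_, ?_⟩, te, ta, tb, tm⟩, ?_, ?_⟩
  · obtain ⟨v, h1, h2, h3⟩ := exists_half_of_not_concurrent (g := b) (h := m) (k := e) bme
    exact ⟨v, h3, h1, h2⟩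
  · obtain ⟨v, h1, h2, h3⟩ := exists_half_of_not_concurrent (g := a) (h := m) (k := e) ame
    exact ⟨v, h3, h1, h2⟩
  · obtain ⟨v, h1, h2, h3⟩ := exists_half_of_not_concurrent (g := a) (h := b) (k := e) abe
    exact ⟨v, h3, h1, h2⟩
  · rintro v ⟨⟨h1, h2⟩, h3⟩
    exact ⟨⟨h1, h2⟩, not_not.1 fun h' => hopp v h2 h' h3⟩
  · obtain ⟨v, h1, h2, h3⟩ := exists_half_of_not_concurrent (g := a) (h := c) (k := opp m) acm
    have hvb : v ∈ half σ b := not_not.1 fun h' => mem_opp.1 h3 (hm.left ⟨mem_opp.2 h', h2⟩)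
    exact fun hss => mem_opp.1 h3 (hss ⟨⟨h1, hvb⟩, h2⟩).2

/-- There are no quadruples in a critical labelling. -/
theorem IsCritical.not_isQuad [Finite V] (hσ : IsCritical σ) : ¬ IsQuad σ a b c d := by
  intro hq
  obtain ⟨a', b', c', d', h, -, -⟩ := hq.exists_max
  have ht : IsTightQuad σ a' b' c' d' := ⟨h.quad, hσ.tight_fst h, hσ.tight_fst h.swap,
    hσ.tight_fst h.symm, hσ.tight_fst h.symm.swap⟩
  obtain ⟨_, -, ⟨l, a₁, b₁, c₁, hq₁, rfl⟩, hmin⟩ := Finite.exists_le_minimal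
    (p := fun S : Set V => ∃ l a b c, IsTightQuad σ l a b c ∧ S = half σ a ∩ half σ b ∩ half σ c)
    (a := half σ b' ∩ half σ c' ∩ half σ d') ⟨_, _, _, _, ht, rfl⟩
  obtain ⟨l', m, hq₂, hss⟩ := hσ.exists_smaller hq₁
  exact hss.not_subset (@hmin _ ⟨_, _, _, _, hq₂, rfl⟩ hss.subset)

end CubeLabel

/-! ### From quadruples to the Helly property for triples -/

namespace CubeLabel

variable {V : Type*} {I : Type*} {σ : V → I → Bool}

theorem image_val_convex {K : Set V} (hK : BtwConvex σ K) {C : Set K}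
    (hC : BtwConvex (fun v : K => σ v) C) : BtwConvex σ (Subtype.val '' C) := by
  rintro _ ⟨x, hx, rfl⟩ _ ⟨y, hy, rfl⟩ z hz
  exact ⟨⟨z, hK x x.2 y y.2 z hz⟩, hC x hx y hy _ hz, rfl⟩

theorem preimage_val_convex (K : Set V) {C : Set V} (hC : BtwConvex σ C) :
    BtwConvex (fun v : K => σ v) (Subtype.val ⁻¹' C) :=
  fun x hx y hy z hz => hC x hx y hy z hz

theorem Isometric.restrict (hσ : Isometric σ) {K : Set V} (hK : BtwConvex σ K) :
    Isometric (fun v : K => σ v) where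
  finite_diff x y := hσ.finite_diff x y
  step x y hne := by
    obtain ⟨z, i, hi, hf⟩ := hσ.step x y fun h => hne (Subtype.ext h)
    exact ⟨⟨z, hK x x.2 y y.2 z (hf.btw hi)⟩, i, hi, hf⟩

/-- The intersection pattern of a quadruple cannot occur in a finite convex set if all finite
convex sets are stable. -/
theorem Isometric.not_isQuad_restrict (hσ : Isometric σ)
    (hst : ∀ C : Set V, C.Finite → BtwConvex σ C → Stable σ C) {K : Set V} (hfin : K.Finite)
    (hK : BtwConvex σ K) {a b c d : I × Bool} : ¬ IsQuad (fun v : K => σ v) a b c d := by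
  induction hn : K.ncard using Nat.strong_induction_on generalizing K a b c d with
  | _ n ih =>
    intro hq
    have : Finite K := hfin
    refine IsCritical.not_isQuad (σ := fun v : K => σ v) ⟨hσ.restrict hK, ?_, ?_⟩ hq
    · intro C hC h x hx y hy
      have hfr : ∀ x : K, x ∈ front (fun v : K => σ v) C h →
          (x : V) ∈ front σ (Subtype.val '' C) h := by
        rintro x ⟨hxC, hxh, x', hx', hf⟩
        exact ⟨⟨x, hxC, rfl⟩, hxh, x', ⟨x', hx', rfl⟩, hf⟩
      have hhull : ∀ x : K, x ∈ hull (fun v : K => σ v) (front (fun v : K => σ v) C h) →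
          (x : V) ∈ hull σ (front σ (Subtype.val '' C) h) := fun x hx D hD =>
        hx (Subtype.val ⁻¹' D) ⟨preimage_val_convex K hD.1, fun u hu => hD.2 (hfr u hu)⟩
      obtain ⟨w, ⟨⟨w, hwC, rfl⟩, hwh, _, ⟨w', hw', rfl⟩, hf⟩, hb⟩ :=
        hst _ (hfin.subset (Subtype.coe_image_subset K C)) (image_val_convex hK hC) h x (hhull x hx)
          y (hhull y hy)
      exact ⟨w, ⟨hwC, hwh, w', hw', hf⟩, hb⟩
    · intro C hC a b c d hq h1 h2 h3 h4 v
      by_contra hv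
      have hlt : (Subtype.val '' C).ncard < n := by
        rw [← hn]
        refine Set.ncard_lt_ncard ⟨Subtype.coe_image_subset K C, fun hss => hv ?_⟩ hfin
        obtain ⟨w, hw, hwv⟩ := hss v.2
        rwa [← Subtype.ext hwv]
      refine ih _ hlt (hfin.subset (Subtype.coe_image_subset K C)) (image_val_convex hK hC) rfl
        (a := a) (b := b) (c := c) (d := d) ⟨?_, ?_, ?_, ?_, ?_⟩
      · rintro ⟨_, w, hw, rfl⟩ h1 h2 h3 h4
        exact hq.empty w h1 h2 h3 h4
      · obtain ⟨w, hw, h⟩ := h1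
        exact ⟨⟨w, w, hw, rfl⟩, h⟩
      · obtain ⟨w, hw, h⟩ := h2
        exact ⟨⟨w, w, hw, rfl⟩, h⟩
      · obtain ⟨w, hw, h⟩ := h3
        exact ⟨⟨w, w, hw, rfl⟩, h⟩
      · obtain ⟨w, hw, h⟩ := h4
        exact ⟨⟨w, w, hw, rfl⟩, h⟩

theorem empty_convex : BtwConvex σ ∅ := fun _ hx => hx.elim

/-- Points of the hull differ from `a` only in the finitely many coordinates that are not constant
on `A`. -/
theorem Isometric.hull_finite (hσ : Isometric σ) {A : Set V} (hA : A.Finite) :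
    (hull σ A).Finite := by
  rcases A.eq_empty_or_nonempty with rfl | ⟨a, ha⟩
  · exact Set.finite_empty.subset (hull_subset empty_convex le_rfl)
  set D : Set I := ⋃ x ∈ A, {i | σ a i ≠ σ x i} with hD
  have hDfin : D.Finite := hA.biUnion fun x _ => hσ.finite_diff a x
  have hsub : hull σ A ⊆ {v | {i | σ a i ≠ σ v i} ⊆ D} := by
    refine hull_subset ?_ fun x hx i hi => Set.mem_biUnion hx hi
    intro x hx y hy z hz i hi
    by_contra hiD
    have h1 : σ a i = σ x i := not_not.1 fun h => hiD (hx h)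
    have h2 : σ a i = σ y i := not_not.1 fun h => hiD (hy h)
    exact hi (h1.trans (hz i (h1.symm.trans h2)).symm)
  refine Set.Finite.subset (Set.Finite.of_finite_image (f := fun v => {i | σ a i ≠ σ v i})
    (hDfin.finite_subsets.subset ?_) ?_) hsub
  · rintro _ ⟨v, hv, rfl⟩
    exact hv
  · intro v _ w _ hvw
    refine hσ.eq_of_forall fun i => ?_
    have hi : (σ a i ≠ σ v i) ↔ (σ a i ≠ σ w i) := Set.ext_iff.1 hvw i
    cases h1 : σ a i <;> cases h2 : σ v i <;> cases h3 : σ w i <;> simp_all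

/-- The Helly property for half-spaces restricted to a finite convex set. -/
theorem Isometric.helly_half (hσ : Isometric σ)
    (hst : ∀ C : Set V, C.Finite → BtwConvex σ C → Stable σ C) {K : Set V} (hfin : K.Finite)
    (hK : BtwConvex σ K) (s : Finset (I × Bool))
    (hs : ∀ t ⊆ s, t.card ≤ 3 → ∃ v ∈ K, ∀ h ∈ t, v ∈ half σ h) :
    ∃ v ∈ K, ∀ h ∈ s, v ∈ half σ h := by
  classical
  induction hn : s.card using Nat.strong_induction_on generalizing s with
  | _ n ih =>
    by_cases hcard : s.card ≤ 3
    · exact hs s subset_rfl hcard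
    by_contra hcon
    obtain ⟨r, hr, hr4⟩ := Finset.exists_subset_card_eq (s := s) (n := 4) (by omega)
    obtain ⟨a, r', har, rfl, hr3⟩ := Finset.card_eq_succ.1 hr4
    obtain ⟨b, c, d, hbc, hbd, hcd, rfl⟩ := Finset.card_eq_three.1 hr3
    simp only [Finset.mem_insert, Finset.mem_singleton, not_or] at har
    obtain ⟨hab, hac, had⟩ := har
    have ha : a ∈ s := hr (by simp)
    have hb : b ∈ s := hr (by simp)
    have hc : c ∈ s := hr (by simp)
    have hd : d ∈ s := hr (by simp)
    have herase : ∀ e ∈ s, ∃ v ∈ K, ∀ h ∈ s, h ≠ e → v ∈ half σ h := by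
      intro e he
      obtain ⟨v, hv, hv'⟩ := ih _ (hn ▸ Finset.card_erase_lt_of_mem he) (s.erase e)
        (fun t ht => hs t (ht.trans (Finset.erase_subset _ _))) rfl
      exact ⟨v, hv, fun h hh hne => hv' h (Finset.mem_erase.2 ⟨hne, hh⟩)⟩
    -- All half-spaces but the chosen four are absorbed into `L`. The induction hypothesis for the
    -- family without one of the four supplies each triple intersection.
    set L : Set V := {v | v ∈ K ∧ ∀ h ∈ s, h ≠ a → h ≠ b → h ≠ c → h ≠ d → v ∈ half σ h} with hL
    have hLK : L ⊆ K := fun v hv => hv.1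
    have hLc : BtwConvex σ L := fun x hx y hy z hz => ⟨hK x hx.1 y hy.1 z hz,
      fun h hh h1 h2 h3 h4 => half_convex h x (hx.2 h hh h1 h2 h3 h4) y
        (hy.2 h hh h1 h2 h3 h4) z hz⟩
    refine hσ.not_isQuad_restrict hst (hfin.subset hLK) hLc (a := a) (b := b) (c := c) (d := d)
      ⟨?_, ?_, ?_, ?_, ?_⟩
    · rintro ⟨v, hv⟩ h1 h2 h3 h4
      refine hcon ⟨v, hv.1, fun h hh => ?_⟩
      by_cases ea : h = a
      · exact ea ▸ h1
      by_cases eb : h = b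
      · exact eb ▸ h2
      by_cases ec : h = c
      · exact ec ▸ h3
      by_cases ed : h = d
      · exact ed ▸ h4
      exact hv.2 h hh ea eb ec ed
    · obtain ⟨v, hv, h⟩ := herase a ha
      exact ⟨⟨v, hv, fun k hk h1 _ _ _ => h k hk h1⟩, h b hb (Ne.symm hab), h c hc (Ne.symm hac),
        h d hd (Ne.symm had)⟩
    · obtain ⟨v, hv, h⟩ := herase b hb
      exact ⟨⟨v, hv, fun k hk _ h1 _ _ => h k hk h1⟩, h a ha hab, h c hc hbc.symm,
        h d hd hbd.symm⟩
    · obtain ⟨v, hv, h⟩ := herase c hc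
      exact ⟨⟨v, hv, fun k hk _ _ h1 _ => h k hk h1⟩, h a ha hac, h b hb hbc, h d hd hcd.symm⟩
    · obtain ⟨v, hv, h⟩ := herase d hd
      exact ⟨⟨v, hv, fun k hk _ _ _ h1 => h k hk h1⟩, h a ha had, h b hb hbd, h c hc hcd⟩

/-- If all finite convex sets are stable, then finite families of convex sets, any three of
which intersect, have a common point. -/
theorem Isometric.helly_three (hσ : Isometric σ)
    (hst : ∀ C : Set V, C.Finite → BtwConvex σ C → Stable σ C) {n : ℕ} (F : Fin n → Set V)
    (hF : ∀ i, BtwConvex σ (F i))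
    (h3 : ∀ s : Finset (Fin n), s.card ≤ 3 → (⋂ i ∈ s, F i).Nonempty) : (⋂ i, F i).Nonempty := by
  classical
  have h3' : ∀ s : Finset (Fin n), ∃ v, s.card ≤ 3 → ∀ i ∈ s, v ∈ F i := by
    intro s
    by_cases hs : s.card ≤ 3
    · obtain ⟨v, hv⟩ := h3 s hs
      exact ⟨v, fun _ i hi => Set.mem_iInter₂.1 hv i hi⟩
    · obtain ⟨v, -⟩ := h3 ∅ (by simp)
      exact ⟨v, fun h => absurd h hs⟩
  choose p hp using h3'
  set K := hull σ (Set.range p)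
  have hKfin : K.Finite := hσ.hull_finite (Set.finite_range p)
  have hK : BtwConvex σ K := hull_convex _
  have hpK : ∀ s, p s ∈ K := fun s => subset_hull _ ⟨s, rfl⟩
  by_contra hcon
  -- Each `v` misses some `F i`. The half-spaces so obtained for `v` in the finite set `K` form a
  -- finite family with no common point in `K`.
  have hsep : ∀ v : V, ∃ (i : Fin n) (h : I × Bool), F i ∩ K ⊆ half σ h ∧ (v ∈ K → v ∉ half σ h) := by
    intro v
    have hv : ∃ i, v ∉ F i := by
      by_contra hv
      exact hcon ⟨v, Set.mem_iInter.2 fun i => not_not.1 fun h => hv ⟨i, h⟩⟩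
    obtain ⟨i, hi⟩ := hv
    obtain ⟨h, hh, hvh⟩ := hσ.exists_half ((hF i).inter hK)
      ⟨p {i}, hp {i} (by simp) i (by simp), hpK _⟩ fun h => hi h.1
    exact ⟨i, h, hh, fun _ => hvh⟩
  choose ι η hη hη' using hsep
  obtain ⟨v, hvK, hv⟩ := hσ.helly_half hst hKfin hK (hKfin.toFinset.image η) (by
    intro t ht htc
    have : ∀ h, ∃ i, h ∈ t → F i ∩ K ⊆ half σ h := by
      intro h
      by_cases hh : h ∈ t
      · obtain ⟨v, -, rfl⟩ := Finset.mem_image.1 (ht hh)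
        exact ⟨ι v, fun _ => hη v⟩
      · exact ⟨ι (p ∅), fun h' => absurd h' hh⟩
    choose j hj using this
    exact ⟨p (t.image j), hpK _, fun h hh => hj h hh
      ⟨hp _ (Finset.card_image_le.trans htc) _ (Finset.mem_image_of_mem j hh), hpK _⟩⟩)
  exact hη' v hvK (hv _ (Finset.mem_image_of_mem η (hKfin.mem_toFinset.2 hvK)))

end CubeLabel

/-! ### Graph distance, labellings, and stability from the pre-hull number -/

namespace CubeLabel

open SimpleGraph

variable {V : Type*} {I : Type*} {σ : V → I → Bool} {G : SimpleGraph V}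

/-- `σ` labels the vertices of `G` as those of an isometric subgraph of a hypercube. -/
structure Labels (σ : V → I → Bool) (G : SimpleGraph V) : Prop where
  isometric : Isometric σ
  adj_iff : ∀ x y, G.Adj x y ↔ ∃ i, Flip σ i x y

theorem diff_subset_union (x y z : V) :
    {i | σ x i ≠ σ y i} ⊆ {i | σ x i ≠ σ z i} ∪ {i | σ z i ≠ σ y i} := by
  intro i hi
  by_contra h
  simp only [Set.mem_union, Set.mem_ofPred_eq, not_or, not_not] at h
  exact hi (h.1.trans h.2)

theorem Flip.diff_eq {i : I} {x y : V} (h : Flip σ i x y) : {j | σ x j ≠ σ y j} = {i} := by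
  ext j
  by_cases hj : j = i
  · subst hj
    simpa using h.1.symm
  · simpa [hj] using (h.2 j hj).symm

theorem exists_flip_iff {x y : V} :
    (∃ i, Flip σ i x y) ↔ {j | σ x j ≠ σ y j}.ncard = 1 := by
  rw [Set.ncard_eq_one]
  refine exists_congr fun i => ⟨fun h => h.diff_eq, fun h => ⟨?_, fun j hj => ?_⟩⟩
  · exact (show i ∈ {j | σ x j ≠ σ y j} by simp [h]).symm
  · by_contra hne
    have : j ∈ {j | σ x j ≠ σ y j} := Ne.symm hne
    rw [h] at this
    exact hj this

theorem Labels.exists_walk (h : Labels σ G) (x y : V) :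
    ∃ p : G.Walk x y, p.length = {i | σ x i ≠ σ y i}.ncard := by
  induction hn : {i | σ x i ≠ σ y i}.ncard using Nat.strong_induction_on generalizing x with
  | _ n ih =>
    by_cases hne : x = y
    · subst hne
      exact ⟨Walk.nil, by simpa using hn⟩
    obtain ⟨z, i, hi, hf⟩ := h.isometric.step x y hne
    have heq : {j | σ x j ≠ σ y j} = insert i {j | σ z j ≠ σ y j} := by
      ext j
      by_cases hj : j = i
      · subst hj
        simpa using hi
      · simp [hj, hf.2 j hj]
    have hni : i ∉ {j | σ z j ≠ σ y j} := fun h' => h' (bool_eq_of_ne hf.1 hi.symm)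
    rw [heq, Set.ncard_insert_of_notMem hni (h.isometric.finite_diff z y)] at hn
    obtain ⟨p, hp⟩ := ih _ (by omega) z rfl
    exact ⟨Walk.cons ((h.adj_iff x z).2 ⟨i, hf⟩) p, by simp [hp, hn]⟩

theorem Labels.ncard_le_length (h : Labels σ G) {x y : V} (p : G.Walk x y) :
    {i | σ x i ≠ σ y i}.ncard ≤ p.length := by
  induction p with
  | nil => simp
  | @cons x z y hadj p ih =>
    obtain ⟨i, hf⟩ := (h.adj_iff x z).1 hadj
    calc {i | σ x i ≠ σ y i}.ncard
        ≤ ({i | σ x i ≠ σ z i} ∪ {i | σ z i ≠ σ y i}).ncard :=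
          Set.ncard_le_ncard (diff_subset_union x y z)
            ((h.isometric.finite_diff x z).union (h.isometric.finite_diff z y))
      _ ≤ {i | σ x i ≠ σ z i}.ncard + {i | σ z i ≠ σ y i}.ncard := Set.ncard_union_le _ _
      _ ≤ _ := by
          rw [hf.diff_eq, Set.ncard_singleton, Walk.length_cons]
          omega

theorem Labels.dist_eq (h : Labels σ G) (x y : V) :
    G.dist x y = {i | σ x i ≠ σ y i}.ncard := by
  obtain ⟨p, hp⟩ := h.exists_walk x y
  refine le_antisymm (hp ▸ dist_le p) ?_
  obtain ⟨q, hq⟩ := (Reachable.exists_walk_length_eq_dist ⟨p⟩ : ∃ q : G.Walk x y, _)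
  exact hq ▸ h.ncard_le_length q

/-- A walk through `z` that changes a coordinate and changes it back is longer than the Hamming
distance of its ends. -/
theorem Labels.mem_geodInterval (h : Labels σ G) {x y z : V} :
    z ∈ G.geodInterval x y ↔ Btw σ x z y := by
  constructor
  · rintro ⟨p, hp, hz⟩ i hi
    by_contra hne
    classical
    have h1 := h.ncard_le_length (p.takeUntil z hz)
    have h2 := h.ncard_le_length (p.dropUntil z hz)
    have h3 := congrArg Walk.length (p.take_spec hz)
    rw [Walk.length_append, hp, h.dist_eq] at h3
    have h4 := Set.ncard_le_ncard (diff_subset_union (σ := σ) x y z)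
      ((h.isometric.finite_diff x z).union (h.isometric.finite_diff z y))
    have h5 := Set.ncard_union_add_ncard_inter _ _ (h.isometric.finite_diff x z)
      (h.isometric.finite_diff z y)
    have h6 : 0 < ({i | σ x i ≠ σ z i} ∩ {i | σ z i ≠ σ y i}).ncard := by
      rw [Set.ncard_pos ((h.isometric.finite_diff x z).inter_of_left _)]
      exact ⟨i, Ne.symm hne, fun h' => hne (h'.trans hi.symm)⟩
    omega
  · intro hb
    obtain ⟨p, hp⟩ := h.exists_walk x z
    obtain ⟨q, hq⟩ := h.exists_walk z y
    refine ⟨p.append q, ?_, by simp [Walk.mem_support_append_iff]⟩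
    have heq : {i | σ x i ≠ σ y i} = {i | σ x i ≠ σ z i} ∪ {i | σ z i ≠ σ y i} := by
      refine (diff_subset_union x y z).antisymm ?_
      rintro i (hi | hi)
      · exact (hb.ne (Ne.symm hi)).symm
      · exact hb.symm.ne hi
    rw [Walk.length_append, hp, hq, h.dist_eq, heq, Set.ncard_union_eq _
      (h.isometric.finite_diff x z) (h.isometric.finite_diff z y)]
    rw [Set.disjoint_left]
    intro i hi hi'
    exact hb.ne (Ne.symm hi) (bool_eq_of_ne (Ne.symm hi') hi)

theorem Labels.isGeodConvex_iff (h : Labels σ G) {C : Set V} :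
    G.IsGeodConvex C ↔ BtwConvex σ C :=
  forall₄_congr fun _ _ _ _ => forall_congr' fun _ => by rw [h.mem_geodInterval]

theorem Labels.induce (h : Labels σ G) {S : Set V} (hS : BtwConvex σ S) :
    Labels (fun v : S => σ v) (G.induce S) where
  isometric := h.isometric.restrict hS
  adj_iff x y := h.adj_iff x y

/-- Pre-hull number at most one makes the whole graph stable: the half-space opposite to a
front is a copoint at every vertex of the hull of the front. -/
theorem Labels.stable_of_preHullNumber_le_one (h : Labels σ G) (hph : G.preHullNumber ≤ 1) :
    Stable σ Set.univ := by
  intro k x hx y hy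
  obtain ⟨_, ⟨n, rfl, hn⟩, hn2⟩ := sInf_lt_iff.1 (hph.trans_lt (by norm_num : (1 : ℕ∞) < 2))
  have hsub : hull σ (front σ Set.univ k) ⊆ half σ k :=
    hull_subset (half_convex k) fun u hu => hu.2.1
  obtain ⟨u₀, hu₀⟩ : (front σ Set.univ k).Nonempty := by
    by_contra hne
    exact hull_subset empty_convex (Set.not_nonempty_iff_eq_empty.1 hne).subset hx
  -- Every front vertex lies between any `v` in `k` and its own neighbour across `k`.
  have hspan : ∀ D, BtwConvex σ D → half σ (opp k) ⊆ D → (∃ v ∈ D, v ∈ half σ k) →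
      hull σ (front σ Set.univ k) ⊆ D := by
    rintro D hD hkD ⟨v, hvD, hvk⟩
    refine hull_subset hD ?_
    rintro u ⟨-, huk, u', -, hf⟩
    have hu' := mem_opp.2 (hf.mem_opp huk)
    refine hD v hvD u' (hkD hu') u (hf.symm.btw fun h' => ?_).symm
    exact mem_opp.1 hu' (h'.trans hvk)
  have hcop : G.IsCopointAt (half σ (opp k)) x := by
    refine ⟨⟨h.isGeodConvex_iff.2 (half_convex _), fun hx' => mem_opp.1 hx' (hsub hx)⟩, ?_⟩
    rintro D ⟨hD, hxD⟩ hkD v hv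
    by_contra hvk
    exact hxD (hspan D (h.isGeodConvex_iff.1 hD) hkD ⟨v, hv, not_not.1 (mem_opp.not.1 hvk)⟩ hx)
  have hyhull : y ∈ G.geodHull (half σ (opp k) ∪ {x}) := by
    rintro D ⟨hD, hsubD⟩
    exact hspan D (h.isGeodConvex_iff.1 hD) (Set.subset_union_left.trans hsubD)
      ⟨x, hsubD (Or.inr rfl), hsub hx⟩ hy
  rw [hn x _ hcop] at hyhull
  have hyk : y ∉ half σ (opp k) := fun h' => mem_opp.1 h' (hsub hy)
  have hex : y = x ∨ ∃ z ∈ half σ (opp k), Btw σ x y z := by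
    -- The infimum only yields some attained `n < 2`, so `n = 0` needs its own case.
    have hn2' : n < 2 := by exact_mod_cast hn2
    interval_cases n
    · exact Or.inl (hyhull.resolve_left hyk)
    · simp only [Function.iterate_one, preHull, Set.mem_iUnion] at hyhull
      obtain ⟨p, hp, q, hq, hpq⟩ := hyhull
      rw [h.mem_geodInterval] at hpq
      rcases hp with hp | rfl <;> rcases hq with hq | rfl
      · exact absurd (half_convex _ p hp q hq y hpq) hyk
      · exact Or.inr ⟨p, hp, hpq.symm⟩
      · exact Or.inr ⟨q, hq, hpq⟩
      · exact Or.inl (h.isometric.eq_of_forall fun i => hpq i rfl)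
  rcases hex with rfl | ⟨z, hz, hb⟩
  · exact ⟨u₀, hu₀, btw_left _ _⟩
  · obtain ⟨u, hu, u', hu', h1, -, h3, h4⟩ := h.isometric.exists_cross univ_convex
      (Set.mem_univ y) (hsub hy) (Set.mem_univ z) (mem_opp.1 hz)
    exact ⟨u, (exists_front_of_flip hu hu' h3 h1).1, hb.trans_mid h4⟩

theorem Labels.stable_of_isPhHomogeneous (h : Labels σ G) (hG : G.IsPhHomogeneous) (C : Set V)
    (hfin : C.Finite) (hC : BtwConvex σ C) : Stable σ C := by
  have hst := (h.induce hC).stable_of_preHullNumber_le_one (hG C hfin (h.isGeodConvex_iff.2 hC))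
  intro k x hx y hy
  have hCx : hull σ (front σ C k) ⊆ C := hull_subset hC fun u hu => hu.1
  have hhull : ∀ z : C, (z : V) ∈ hull σ (front σ C k) →
      z ∈ hull (fun v : C => σ v) (front (fun v : C => σ v) Set.univ k) := by
    intro z hz D hD
    obtain ⟨w, hw, hwz⟩ := hz (Subtype.val '' D) ⟨image_val_convex hC hD.1, by
      rintro u ⟨huC, huk, u', hu', hf⟩
      exact ⟨⟨u, huC⟩, hD.2 ⟨trivial, huk, ⟨u', hu'⟩, trivial, hf⟩, rfl⟩⟩
    rwa [← Subtype.ext hwz]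
  obtain ⟨w, ⟨-, hwk, w', -, hf⟩, hb⟩ := hst k ⟨x, hCx hx⟩ (hhull ⟨x, hCx hx⟩ hx) ⟨y, hCx hy⟩
    (hhull ⟨y, hCx hy⟩ hy)
  exact ⟨w, ⟨w.2, hwk, w', w'.2, hf⟩, hb⟩

open scoped Classical in
-- The hypercube is itself labelled by membership, so `Labels.dist_eq` applies to it.
theorem hypercube_dist_eq {J : Type*} (A B : Finset J) :
    (hypercube J).dist A B = {i | decide (i ∈ A) ≠ decide (i ∈ B)}.ncard := by
  have hset : ∀ A B : Finset J, {i | decide (i ∈ A) ≠ decide (i ∈ B)} = ↑(symmDiff A B) := by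
    intro A B
    ext i
    by_cases h1 : i ∈ A <;> by_cases h2 : i ∈ B <;> simp [h1, h2, Set.mem_symmDiff]
  refine Labels.dist_eq (σ := fun (A : Finset J) i => decide (i ∈ A)) ⟨⟨fun A B => ?_, ?_⟩, ?_⟩ A B
  · rw [hset]
    exact Finset.finite_toSet _
  · intro A B hne
    obtain ⟨i, hi⟩ : ∃ i, ¬ (i ∈ A ↔ i ∈ B) := by
      by_contra hcon
      exact hne (Finset.ext fun i => not_not.1 fun h => hcon ⟨i, h⟩)
    refine ⟨symmDiff A {i}, i, by simpa using hi, ?_, fun j hj => ?_⟩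
    · by_cases h : i ∈ A <;> simp [h, Finset.mem_symmDiff]
    · simp [hj, Finset.mem_symmDiff]
  · intro A B
    rw [exists_flip_iff, hset, Set.ncard_coe_finset]
    rfl

open scoped Classical in
theorem exists_labels.{u} {V : Type u} {G : SimpleGraph V} (hG : G.IsPartialCube) :
    ∃ (J : Type u) (σ : V → J → Bool), Labels σ G := by
  obtain ⟨hconn, J, f, hf⟩ := hG
  have hdist : ∀ x y, G.dist x y = {i | decide (i ∈ f x) ≠ decide (i ∈ f y)}.ncard :=
    fun x y => (hf x y).symm.trans (hypercube_dist_eq _ _)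
  have hfin : ∀ x y, {i | decide (i ∈ f x) ≠ decide (i ∈ f y)}.Finite := by
    intro x y
    refine ((f x ∪ f y).finite_toSet).subset fun i hi => ?_
    by_contra h
    simp only [Finset.coe_union, Set.mem_union, Finset.mem_coe, not_or] at h
    simp [h] at hi
  have hadj : ∀ x y, G.Adj x y ↔ ∃ i, Flip (fun v i => decide (i ∈ f v)) i x y := by
    intro x y
    rw [exists_flip_iff, ← hdist, dist_eq_one_iff_adj]
  refine ⟨J, fun v i => decide (i ∈ f v), ⟨hfin, fun x y hne => ?_⟩, hadj⟩
  obtain ⟨p, hp⟩ := hconn.exists_walk_length_eq_dist x y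
  cases p with
  | nil => exact absurd rfl hne
  | @cons _ z _ hxz q =>
    obtain ⟨i, hi⟩ := (hadj x z).1 hxz
    refine ⟨z, i, fun heq => ?_, hi⟩
    have h1 : G.dist z y ≤ q.length := dist_le q
    rw [Walk.length_cons] at hp
    have h2 : G.dist x y ≤ G.dist z y := by
      rw [hdist, hdist]
      refine Set.ncard_le_ncard (fun j hj => ?_) (hfin z y)
      have hji : j ≠ i := by
        rintro rfl
        exact hj heq
      have : decide (j ∈ f z) = decide (j ∈ f x) := hi.2 j hji
      simp only [Set.mem_ofPred_eq] at hj ⊢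
      rwa [this]
    omega

/-! ### Medians and the Helly property for pairs -/

theorem btw_interval_convex (x y : V) : BtwConvex σ {z | Btw σ x z y} := by
  intro u hu v hv z hz i hi
  rw [hz i ((hu i hi).trans (hv i hi).symm), hu i hi]

theorem Labels.median_unique (h : Labels σ G) {x y z m m' : V}
    (hm : Btw σ x m y ∧ Btw σ y m z ∧ Btw σ z m x)
    (hm' : Btw σ x m' y ∧ Btw σ y m' z ∧ Btw σ z m' x) : m = m' := by
  refine h.isometric.eq_of_forall fun i => ?_
  by_cases h1 : σ x i = σ y i
  · rw [hm.1 i h1, hm'.1 i h1]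
  by_cases h2 : σ y i = σ z i
  · rw [hm.2.1 i h2, hm'.2.1 i h2]
  have h3 : σ z i = σ x i := bool_eq_of_ne (Ne.symm h2) h1
  rw [hm.2.2 i h3, hm'.2.2 i h3]

/-- The intervals spanned by `x`, `y`, `z` are convex and meet pairwise in these vertices; a common
point is a median. -/
theorem Labels.not_hasHellyProperty_two (h : Labels σ G) (hm : ¬ G.IsMedianGraph) :
    ¬ G.HasHellyProperty 2 := by
  intro hH
  refine hm fun x y z => ?_
  have hmem : ∀ m, m ∈ G.geodInterval x y ∩ G.geodInterval y z ∩ G.geodInterval z x ↔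
      Btw σ x m y ∧ Btw σ y m z ∧ Btw σ z m x := fun m => by
    simp only [Set.mem_inter_iff, h.mem_geodInterval, and_assoc]
  simp only [hmem]
  obtain ⟨m, hm⟩ := hH 3 ![{m | Btw σ x m y}, {m | Btw σ y m z}, {m | Btw σ z m x}] (by
    intro i
    rw [h.isGeodConvex_iff]
    fin_cases i <;> exact btw_interval_convex _ _) (by
    intro s hs
    obtain ⟨j, hj⟩ : ∃ j, j ∉ s := by
      by_contra hcon
      have : s = Finset.univ := Finset.eq_univ_iff_forall.2 fun j => not_not.1 fun h => hcon ⟨j, h⟩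
      simp [this] at hs
    have hwit : ∀ w : V, (∀ i, i ≠ j → w ∈ (![{m | Btw σ x m y}, {m | Btw σ y m z},
        {m | Btw σ z m x}] : Fin 3 → Set V) i) → (⋂ i ∈ s, (![{m | Btw σ x m y},
        {m | Btw σ y m z}, {m | Btw σ z m x}] : Fin 3 → Set V) i).Nonempty := fun w hw =>
      ⟨w, Set.mem_iInter₂.2 fun i hi => hw i fun h => hj (h ▸ hi)⟩
    fin_cases j
    · refine hwit z fun i hi => ?_
      fin_cases i
      · exact absurd rfl hi
      · exact btw_right y z
      · exact btw_left z x
    · refine hwit x fun i hi => ?_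
      fin_cases i
      · exact btw_left x y
      · exact absurd rfl hi
      · exact btw_right z x
    · refine hwit y fun i hi => ?_
      fin_cases i
      · exact btw_right x y
      · exact btw_left y z
      · exact absurd rfl hi)
  rw [Set.mem_iInter] at hm
  have hm' : Btw σ x m y ∧ Btw σ y m z ∧ Btw σ z m x := ⟨hm 0, hm 1, hm 2⟩
  exact ⟨m, hm', fun m' h' => h.median_unique h' hm'⟩

end CubeLabel

namespace SimpleGraph

variable {V : Type*} {G : SimpleGraph V}

theorem HasHellyProperty.mono {h k : ℕ} (hhk : h ≤ k) (hG : G.HasHellyProperty h) :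
    G.HasHellyProperty k :=
  fun n F hF hs => hG n F hF fun s hcard => hs s (hcard.trans hhk)

theorem IsGeodConvex.inter {C D : Set V} (hC : G.IsGeodConvex C) (hD : G.IsGeodConvex D) :
    G.IsGeodConvex (C ∩ D) :=
  fun x hx y hy => Set.subset_inter (hC x hx.1 y hy.1) (hD x hx.2 y hy.2)

/-- The median of points taken from the three pairwise intersections lies in all three sets. Larger
families follow by intersecting one member at a time into `C`. -/
theorem IsMedianGraph.hasHellyProperty_two (hG : G.IsMedianGraph) : G.HasHellyProperty 2 := by
  classical
  intro n F hF h2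
  have three : ∀ A B C : Set V, G.IsGeodConvex A → G.IsGeodConvex B → G.IsGeodConvex C →
      (A ∩ B).Nonempty → (B ∩ C).Nonempty → (C ∩ A).Nonempty → (A ∩ B ∩ C).Nonempty := by
    rintro A B C hA hB hC ⟨x, hx⟩ ⟨y, hy⟩ ⟨z, hz⟩
    obtain ⟨m, ⟨⟨h1, h2⟩, h3⟩, -⟩ := hG x y z
    exact ⟨m, ⟨hA z hz.2 x hx.1 h3, hB x hx.2 y hy.1 h1⟩, hC y hy.2 z hz.1 h2⟩
  have hpair : ∀ i j, (F i ∩ F j).Nonempty := by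
    intro i j
    obtain ⟨v, hv⟩ := h2 {i, j} Finset.card_le_two
    rw [Set.mem_iInter₂] at hv
    exact ⟨v, hv i (by simp), hv j (by simp)⟩
  have key : ∀ (s : Finset (Fin n)) (C : Set V), G.IsGeodConvex C → C.Nonempty →
      (∀ i ∈ s, (C ∩ F i).Nonempty) → (C ∩ ⋂ i ∈ s, F i).Nonempty := by
    intro s
    induction s using Finset.induction_on with
    | empty => exact fun C _ hne _ => by simpa using hne
    | insert a s ha ih =>
      intro C hC hne hs
      have := ih (C ∩ F a) (hC.inter (hF a)) (hs a (by simp)) fun i hi =>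
        three C (F a) (F i) hC (hF a) (hF i) (hs a (by simp)) (hpair a i) (by
          rw [Set.inter_comm]
          exact hs i (by simp [hi]))
      rwa [Finset.set_biInter_insert, ← Set.inter_assoc]
  obtain ⟨v, -⟩ := h2 ∅ (by simp)
  have := key Finset.univ Set.univ (fun _ _ _ _ => Set.subset_univ _) ⟨v, trivial⟩ fun i _ => by
    simpa using hpair i i
  simpa using this

theorem HasHellyProperty.hellyNumber_le {h : ℕ} (hG : G.HasHellyProperty h) :
    G.hellyNumber ≤ h :=
  sInf_le ⟨h, rfl, hG⟩

end SimpleGraph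

theorem theoremT {V : Type*} (G : SimpleGraph V) (hG : G.IsPeanoPartialCube) :
    G.hellyNumber ≤ 3 ∧ (G.hellyNumber = 3 ↔ ¬ G.IsMedianGraph) := by
  obtain ⟨J, σ, hσ⟩ := CubeLabel.exists_labels hG.1
  have h3 : G.HasHellyProperty 3 := fun n F hF =>
    hσ.isometric.helly_three (hσ.stable_of_isPhHomogeneous hG.2) F
      fun i => hσ.isGeodConvex_iff.1 (hF i)
  refine ⟨h3.hellyNumber_le, fun h hm => ?_, fun hm => le_antisymm h3.hellyNumber_le ?_⟩
  · have := hm.hasHellyProperty_two.hellyNumber_le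
    rw [h] at this
    exact absurd this (by norm_num)
  · refine le_sInf ?_
    rintro _ ⟨h, rfl, hh⟩
    by_contra hlt
    have hlt' : h < 3 := by exact_mod_cast not_le.1 hlt
    exact hσ.not_hasHellyProperty_two hm (hh.mono (by omega))
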